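/- A connected ordering of a finite graph $G$ is an ordering $(v_1,\dots,v_n)$ of $V(G)$ in which every $v_i$ with $i\ge 2$ has a neighbour in $\{v_1,\dots,v_{i-1}\}$. A connected greedy $k$-coloring of $G$ is a coloring with exactly $k$ colors that is obtained by applying the greedy algorithm (give $v_i$ the least positive integer not yet used on a neighbour of $v_i$, for $i=1,\dots,n$) to a connected ordering. The connected chromatic number $\chi_c(G)$ is the minimum $k$ such that $G$ admits a connected greedy $k$-coloring ($\chi_c(G)=\infty$ if there is none, as for disconnected $G$). Proposition. Let $\mathcal G$ be a class of finite graphs and $k\ge 0$ a fixed integer. Suppose that $\mathcal G$ is closed under the addition of a universal vertex (a new vertex adjacent to all the old ones) and that deciding, given $G\in\mathcal G$, whether $\chi(G)\le k$ is NP-complete. Then deciding, given $G\in\mathcal G$, whether $\chi_c(G)\le k+1$ is NP-complete; and this problem is also NP-complete when restricted to the connected graphs in $\mathcal G$. Moreover, for every finite graph $G$, the graph $G'$ obtained from $G$ by adding a universal vertex satisfies $\chi_c(G')=\chi(G)+1$. Here graphs are given by adjacency matrices, and NP-completeness of deciding a property of a graph on the class $\mathcal G$ means the following. (i) Membership in NP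 on $\mathcal G$: there is a polynomial-time verifier such that a graph $G\in\mathcal G$ has the property if and only if the verifier accepts $G$ together with some certificate of polynomial length. (ii) NP-hardness on $\mathcal G$: every language $L\subseteq\{0,1\}^*$ in NP has a polynomial-time computable map $f$ that takes each string $x$ to a graph $f(x)\in\mathcal G$ such that $x\in L$ if and only if $f(x)$ has the property. -/

import Mathlib

/-! ### Connected greedy colorings -/

section Coloring

variable {V : Type*}

/-- The ordering `v 0, v 1, …, v (n - 1)` of the vertices of `G` is connected: every vertex but the
first has a neighbour among the preceding ones. -/
def IsConnectedOrdering (G : SimpleGraph V) {n : ℕ} (v : Fin n ≃ V) : Prop :=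
  ∀ i : Fin n, 0 < (i : ℕ) → ∃ j : Fin n, j < i ∧ G.Adj (v j) (v i)

/-- `f` is the coloring (colors `1, 2, 3, …`) that the greedy algorithm produces on the ordering
`v 0, v 1, …, v (n - 1)`: each vertex gets the least color that is not yet used on a neighbour. -/
def IsGreedyColoring (G : SimpleGraph V) {n : ℕ} (v : Fin n ≃ V) (f : V → ℕ) : Prop :=
  ∀ i : Fin n,
    IsLeast {c : ℕ | 1 ≤ c ∧ ∀ j : Fin n, j < i → G.Adj (v j) (v i) → f (v j) ≠ c} (f (v i))

/-- `G` has a connected greedy `k`-coloring: applying the greedy algorithm to some connected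
ordering of all the vertices produces a coloring in which exactly `k` colors occur. -/
def HasConnectedGreedyColoring (G : SimpleGraph V) (k : ℕ) : Prop :=
  ∃ (n : ℕ) (v : Fin n ≃ V) (f : V → ℕ),
    IsConnectedOrdering G v ∧ IsGreedyColoring G v f ∧ (Set.range f).ncard = k

/-- The connected chromatic number: the minimum `k` for which `G` has a connected greedy
`k`-coloring. It is `⊤` if there is none (that is, for a finite graph, if it is disconnected). -/
noncomputable def connectedChromaticNumber (G : SimpleGraph V) : ℕ∞ :=
  ⨅ k ∈ {k : ℕ | HasConnectedGreedyColoring G k}, (k : ℕ∞)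

end Coloring

/-! ### Finite graphs as problem instances -/

/-- The finite graphs (with vertex set `{0, …, n - 1}`). -/
abbrev FinGraph : Type := Σ n : ℕ, SimpleGraph (Fin n)

/-- The graph obtained from `G` by adding a universal vertex, that is, a new vertex that is adjacent
to all the old ones. The new vertex is `Fin.last n`. -/
def addUniversalVertex {n : ℕ} (G : SimpleGraph (Fin n)) : SimpleGraph (Fin (n + 1)) :=
  G.map Fin.castSucc ⊔ SimpleGraph.fromRel (fun u _ => u = Fin.last n)

open Classical in
/-- The encoding of a graph as a string: its adjacency matrix, row by row, where `some true` and
`some false` are the bits and the symbol `none` ends a row. -/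
noncomputable def encodeGraph (G : FinGraph) : List (Option Bool) :=
  (List.finRange G.1).flatMap fun i =>
    (List.finRange G.1).map (fun j => some (decide (G.2.Adj i j))) ++ [none]

/-! ### NP-completeness

A decision problem is given by a type `α` of objects with an encoding `e` of them as strings over a
finite alphabet, a set `I` of admissible instances and a set `Y` of objects with answer "yes"; the
problem is to decide, given `a ∈ I`, whether `a ∈ Y`. -/

/-- `f` can be computed in polynomial time by a (deterministic, multi-stack) Turing machine. -/
def PolyTimeComputable {α β Γ Δ : Type} (ea : α → List Γ) (eb : β → List Δ) (f : α → β) : Prop :=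
  Nonempty (Turing.TM2ComputableInPolyTime ea eb f)

/-- The encoding of an object together with a certificate, over the disjoint union of the two
alphabets. -/
def encodeWithCertificate {α Γ : Type} (e : α → List Γ) (x : α × List Bool) : List (Γ ⊕ Bool) :=
  (e x.1).map Sum.inl ++ x.2.map Sum.inr

/-- The problem is in NP: there is a polynomial-time verifier `V` such that an instance `a` has
answer "yes" if and only if `V` accepts `a` with some certificate of polynomial length. -/
def InNP {α Γ : Type} (e : α → List Γ) (I Y : Set α) : Prop :=
  ∃ (p : Polynomial ℕ) (V : α × List Bool → Bool),
    PolyTimeComputable (encodeWithCertificate e) Computability.encodeBool V ∧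
    ∀ a ∈ I, a ∈ Y ↔ ∃ y : List Bool, y.length ≤ p.eval (e a).length ∧ V (a, y) = true

/-- The problem is NP-hard: every language in NP over the alphabet `{0, 1}` has a polynomial-time
many-one reduction to it, all of whose values are admissible instances. -/
def NPHard {α Γ : Type} (e : α → List Γ) (I Y : Set α) : Prop :=
  ∀ L : Set (List Bool), InNP (id : List Bool → List Bool) Set.univ L →
    ∃ f : List Bool → α, PolyTimeComputable (id : List Bool → List Bool) e f ∧
      ∀ x, f x ∈ I ∧ (x ∈ L ↔ f x ∈ Y)

/-- The problem is NP-complete. -/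
def NPComplete {α Γ : Type} (e : α → List Γ) (I Y : Set α) : Prop :=
  InNP e I Y ∧ NPHard e I Y

/-- Deciding, for a graph `G` in the class `𝒢`, whether `χ(G) ≤ k` is NP-complete. -/
def ColoringNPComplete (𝒢 : Set FinGraph) (k : ℕ) : Prop :=
  NPComplete encodeGraph 𝒢 {G | G.2.chromaticNumber ≤ (k : ℕ∞)}

/-- Deciding, for a graph `G` in the class `𝒢`, whether `χ_c(G) ≤ k` is NP-complete. -/
def ConnectedColoringNPComplete (𝒢 : Set FinGraph) (k : ℕ) : Prop :=
  NPComplete encodeGraph 𝒢 {G | connectedChromaticNumber G.2 ≤ (k : ℕ∞)}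

/-! Let `G'` be `G` with a universal vertex `u`. In a proper coloring of `G'` the color of `u`
occurs nowhere else, so a coloring with `k` colors leaves `k - 1` of them for `G`. Conversely, order
the vertices of `G'` by the classes of an optimal coloring of `G`, with `u` in front. Every later
vertex is adjacent to `u`, so the ordering is connected, and the greedy algorithm never exceeds the
index of a class. This gives the equality (`connectedChromaticNumber_addUniversalVertex`).

Hardness follows by composing a given reduction with `G ↦ G'`. As `G'` is always connected, the same
reduction serves the connected graphs of the class. On the machine level this needs that
polynomial-time functions compose (`PolyTimeComputable.comp`) and that one concrete machine extends
an adjacency matrix (`polyTimeComputable_addUniversalVertex`).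

Membership in NP holds on every class of graphs. A certificate gives each vertex one number `m v`:
its residue modulo `k + 1` is the color, and its size determines the position in the ordering. Both
the greedy rule and connectedness become conditions on single rows of the matrix, apart from the
requirement that at most one vertex has no earlier neighbour (`IsCertificate`). The numbers are
polynomially bounded, so they can be written in unary and compared by popping stacks in parallel.
`verProgram` does this, with only residues and flags in its finite state. -/

/-! ### Bounded reachability of stack machines -/

section Reachability

open Turing

variable {K : Type} [DecidableEq K] {Γ : K → Type} {Λ σ : Type}

/-- The configuration `b` is reached from `a` in at most `t` steps of the machine `M`. -/
def ReachesIn (M : Λ → TM2.Stmt Γ Λ σ) (a b : TM2.Cfg Γ Λ σ) (t : ℕ) : Prop :=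
  ∃ s ≤ t, (fun x => Option.bind x (TM2.step M))^[s] (some a) = some b

variable {M : Λ → TM2.Stmt Γ Λ σ} {a b c : TM2.Cfg Γ Λ σ} {s t : ℕ}

theorem ReachesIn.refl (a : TM2.Cfg Γ Λ σ) (t : ℕ) : ReachesIn M a a t :=
  ⟨0, Nat.zero_le _, rfl⟩

theorem ReachesIn.trans (h : ReachesIn M a b s) (h' : ReachesIn M b c t) :
    ReachesIn M a c (s + t) := by
  obtain ⟨m, hm, h⟩ := h
  obtain ⟨n, hn, h'⟩ := h'
  refine ⟨n + m, by omega, ?_⟩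
  rw [Function.iterate_add_apply, h, h']

theorem ReachesIn.mono (h : ReachesIn M a b s) (hst : s ≤ t) : ReachesIn M a b t := by
  obtain ⟨m, hm, h⟩ := h
  exact ⟨m, hm.trans hst, h⟩

theorem ReachesIn.single (h : TM2.step M a = some b) : ReachesIn M a b 1 :=
  ⟨1, le_rfl, h⟩

theorem ReachesIn.head (h : TM2.step M a = some b) (h' : ReachesIn M b c t) :
    ReachesIn M a c (t + 1) :=
  ((ReachesIn.single h).trans h').mono (by omega)

/-- The number of symbols that a statement pushes at most. -/
def pushBound : TM2.Stmt Γ Λ σ → ℕ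
  | .push _ _ q => pushBound q + 1
  | .peek _ _ q => pushBound q
  | .pop _ _ q => pushBound q
  | .load _ q => pushBound q
  | .branch _ q₁ q₂ => max (pushBound q₁) (pushBound q₂)
  | .goto _ => 0
  | .halt => 0

theorem length_stepAux_le (q : TM2.Stmt Γ Λ σ) (v : σ) (S : ∀ k, List (Γ k)) (k : K) :
    ((TM2.stepAux q v S).stk k).length ≤ (S k).length + pushBound q := by
  induction q generalizing v S with
  | push k' f q ih =>
    refine (ih _ _).trans ?_
    by_cases h : k = k'
    · subst h; simp [pushBound]; omega
    · rw [Function.update_of_ne h, pushBound]; omega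
  | peek k' f q ih => exact ih _ _
  | pop k' f q ih =>
    refine (ih _ _).trans ?_
    by_cases h : k = k'
    · subst h; simp [pushBound]
    · simp [pushBound, Function.update_of_ne h]
  | load f q ih => exact ih _ _
  | branch f q₁ q₂ ih₁ ih₂ =>
    simp only [TM2.stepAux, pushBound]
    cases f v
    · exact (ih₂ _ _).trans (by simp)
    · exact (ih₁ _ _).trans (by simp)
  | goto f => simp [TM2.stepAux, pushBound]
  | halt => simp [TM2.stepAux, pushBound]

/-- A step runs a single statement, so each stack grows at most linearly in time. In a composition
this bounds the input of the second machine. -/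
theorem ReachesIn.length_le {B : ℕ} (hB : ∀ l, pushBound (M l) ≤ B) (h : ReachesIn M a b t)
    (k : K) : (b.stk k).length ≤ (a.stk k).length + B * t := by
  obtain ⟨s, hs, h⟩ := h
  suffices (b.stk k).length ≤ (a.stk k).length + B * s from
    this.trans (by gcongr)
  clear hs
  induction s generalizing b with
  | zero =>
    obtain rfl : a = b := by simpa using h
    simp
  | succ s ih =>
    rw [Function.iterate_succ_apply'] at h
    obtain ⟨c, hc, hcb⟩ := Option.bind_eq_some_iff.1 h
    have h₁ := ih hc
    obtain ⟨_ | l, v, S⟩ := c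
    · simp at hcb
    · simp only [TM2.step, Option.some.injEq] at hcb
      subst hcb
      have := length_stepAux_le (M l) v S k
      have := hB l
      dsimp only at h₁
      rw [mul_add]
      omega

theorem ReachesIn.evalsToInTime {tm : FinTM2} {a b : tm.Cfg} {t : ℕ}
    (h : ReachesIn tm.m a b t) :
    Nonempty (StateTransition.EvalsToInTime tm.step a (some b) t) := by
  obtain ⟨s, hs, h⟩ := h
  exact ⟨⟨⟨s, h⟩, hs⟩⟩

theorem reachesIn_of_evalsToInTime {tm : FinTM2} {a b : tm.Cfg} {t : ℕ}
    (h : StateTransition.EvalsToInTime tm.step a (some b) t) : ReachesIn tm.m a b t :=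
  ⟨h.steps, h.steps_le_m, h.evals_in_steps⟩

end Reachability

theorem exists_pushBound {K : Type} {Γ : K → Type} {Λ σ : Type} [Finite Λ]
    (M : Λ → Turing.TM2.Stmt Γ Λ σ) : ∃ B, ∀ l, pushBound (M l) ≤ B := by
  obtain ⟨B, hB⟩ := (Set.finite_range fun l => pushBound (M l)).bddAbove
  exact ⟨B, fun l => hB ⟨l, rfl⟩⟩

/-- Natural coefficients make the polynomial monotone, so a time bound may be evaluated at an upper
bound for the input length. -/
theorem natPolynomial_eval_mono (p : Polynomial ℕ) {m n : ℕ} (h : m ≤ n) :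
    p.eval m ≤ p.eval n := by
  rw [Polynomial.eval_eq_sum_range, Polynomial.eval_eq_sum_range]
  gcongr

/-! ### Composition of polynomial-time computable functions -/

section Composition

open Turing

variable (tm₁ tm₂ : FinTM2) {Δ : Type} (e₁ : tm₁.Γ tm₁.k₁ ≃ Δ) (e₂ : tm₂.Γ tm₂.k₀ ≃ Δ)

/-- The stack alphabets of the composed machine: those of both machines, and an auxiliary stack. -/
abbrev CompΓ (Δ : Type) : Option (tm₁.K ⊕ tm₂.K) → Type
  | none => Δ
  | some (.inl k) => tm₁.Γ k
  | some (.inr k) => tm₂.Γ k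

/-- The labels of the composed machine. The label `inr (inr false)` moves the output of the first
machine to the auxiliary stack, `inr (inr true)` moves it on to the input stack of the second. -/
abbrev CompΛ : Type := tm₁.Λ ⊕ tm₂.Λ ⊕ Bool

/-- The internal states of the composed machine, with a register for the symbol being moved. -/
abbrev CompState (Δ : Type) : Type := tm₁.σ × tm₂.σ × Option Δ

/-- A statement of the first machine as a statement of the composed machine. -/
def liftFst : TM2.Stmt tm₁.Γ tm₁.Λ tm₁.σ →
    TM2.Stmt (CompΓ tm₁ tm₂ Δ) (CompΛ tm₁ tm₂) (CompState tm₁ tm₂ Δ)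
  | .push k f q => .push (some (.inl k)) (fun s => f s.1) (liftFst q)
  | .peek k f q => .peek (some (.inl k)) (fun s x => (f s.1 x, s.2)) (liftFst q)
  | .pop k f q => .pop (some (.inl k)) (fun s x => (f s.1 x, s.2)) (liftFst q)
  | .load f q => .load (fun s => (f s.1, s.2)) (liftFst q)
  | .branch f q₁ q₂ => .branch (fun s => f s.1) (liftFst q₁) (liftFst q₂)
  | .goto f => .goto fun s => .inl (f s.1)
  | .halt => .goto fun _ => .inr (.inr false)

/-- A statement of the second machine as a statement of the composed machine. -/
def liftSnd : TM2.Stmt tm₂.Γ tm₂.Λ tm₂.σ →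
    TM2.Stmt (CompΓ tm₁ tm₂ Δ) (CompΛ tm₁ tm₂) (CompState tm₁ tm₂ Δ)
  | .push k f q => .push (some (.inr k)) (fun s => f s.2.1) (liftSnd q)
  | .peek k f q => .peek (some (.inr k)) (fun s x => (s.1, f s.2.1 x, s.2.2)) (liftSnd q)
  | .pop k f q => .pop (some (.inr k)) (fun s x => (s.1, f s.2.1 x, s.2.2)) (liftSnd q)
  | .load f q => .load (fun s => (s.1, f s.2.1, s.2.2)) (liftSnd q)
  | .branch f q₁ q₂ => .branch (fun s => f s.2.1) (liftSnd q₁) (liftSnd q₂)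
  | .goto f => .goto fun s => .inr (.inl (f s.2.1))
  | .halt => .halt

variable {tm₁ tm₂}

/-- The program of the composed machine. -/
def compProgram (d : Δ) :
    CompΛ tm₁ tm₂ → TM2.Stmt (CompΓ tm₁ tm₂ Δ) (CompΛ tm₁ tm₂) (CompState tm₁ tm₂ Δ)
  | .inl l => liftFst tm₁ tm₂ (tm₁.m l)
  | .inr (.inl l) => liftSnd tm₁ tm₂ (tm₂.m l)
  | .inr (.inr false) =>
    .pop (some (.inl tm₁.k₁)) (fun s x => (s.1, s.2.1, Option.map e₁ x)) <|
    .branch (fun s => s.2.2.isSome)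
      (.push none (fun s => (s.2.2.getD d : Δ)) <|
       .load (fun s => (s.1, s.2.1, none)) <| .goto fun _ => .inr (.inr false))
      (.goto fun _ => .inr (.inr true))
  | .inr (.inr true) =>
    .pop none (fun s x => (s.1, s.2.1, x)) <|
    .branch (fun s => s.2.2.isSome)
      (.push (some (.inr tm₂.k₀)) (fun s => e₂.symm (s.2.2.getD d : Δ)) <|
       .load (fun s => (s.1, s.2.1, none)) <| .goto fun _ => .inr (.inr true))
      (.goto fun _ => .inr (.inl tm₂.main))

variable (tm₁ tm₂) in
/-- The stacks of the composed machine. -/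
def compStk (S₁ : ∀ k, List (tm₁.Γ k)) (S₂ : ∀ k, List (tm₂.Γ k)) (l : List Δ) :
    ∀ k, List (CompΓ tm₁ tm₂ Δ k)
  | none => l
  | some (.inl k) => S₁ k
  | some (.inr k) => S₂ k

section
variable (S₁ : ∀ k, List (tm₁.Γ k)) (S₂ : ∀ k, List (tm₂.Γ k)) (l : List Δ)

theorem update_compStk_inl (k : tm₁.K) (x : List (tm₁.Γ k)) :
    Function.update (compStk tm₁ tm₂ S₁ S₂ l) (some (.inl k)) x =
      compStk tm₁ tm₂ (Function.update S₁ k x) S₂ l := by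
  funext k'
  rcases k' with _ | k' | k'
  · rfl
  · by_cases h : k' = k
    · subst h; simp [compStk]
    · rw [Function.update_of_ne (by simpa using h)]; simp [compStk, h]
  · rfl

theorem update_compStk_inr (k : tm₂.K) (x : List (tm₂.Γ k)) :
    Function.update (compStk tm₁ tm₂ S₁ S₂ l) (some (.inr k)) x =
      compStk tm₁ tm₂ S₁ (Function.update S₂ k x) l := by
  funext k'
  rcases k' with _ | k' | k'
  · rfl
  · rfl
  · by_cases h : k' = k
    · subst h; simp [compStk]
    · rw [Function.update_of_ne (by simpa using h)]; simp [compStk, h]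

theorem update_compStk_none (x : List Δ) :
    Function.update (compStk tm₁ tm₂ S₁ S₂ l) none x = compStk tm₁ tm₂ S₁ S₂ x := by
  funext k'
  rcases k' with _ | k' | k' <;> rfl

/-- A configuration of the first machine as a configuration of the composed machine. -/
def embFst (r : tm₂.σ × Option Δ) (c : TM2.Cfg tm₁.Γ tm₁.Λ tm₁.σ) :
    TM2.Cfg (CompΓ tm₁ tm₂ Δ) (CompΛ tm₁ tm₂) (CompState tm₁ tm₂ Δ) :=
  ⟨some (c.l.elim (.inr (.inr false)) .inl), (c.var, r), compStk tm₁ tm₂ c.stk S₂ l⟩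

/-- A configuration of the second machine as a configuration of the composed machine. -/
def embSnd (v : tm₁.σ) (r : Option Δ) (c : TM2.Cfg tm₂.Γ tm₂.Λ tm₂.σ) :
    TM2.Cfg (CompΓ tm₁ tm₂ Δ) (CompΛ tm₁ tm₂) (CompState tm₁ tm₂ Δ) :=
  ⟨c.l.map fun x => .inr (.inl x), (v, c.var, r), compStk tm₁ tm₂ S₁ c.stk l⟩

/-- A lifted statement touches only the stacks and the state component of its own machine. Halting
becomes a jump to the first transfer label, which is where `embFst` sends a halted configuration. -/
theorem stepAux_liftFst (q : TM2.Stmt tm₁.Γ tm₁.Λ tm₁.σ) (v : tm₁.σ) (r : tm₂.σ × Option Δ) :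
    TM2.stepAux (liftFst tm₁ tm₂ q) (v, r) (compStk tm₁ tm₂ S₁ S₂ l) =
      embFst S₂ l r (TM2.stepAux q v S₁) := by
  induction q generalizing v S₁ with
  | push k f q ih =>
    simp only [liftFst, TM2.stepAux]
    rw [← ih, ← update_compStk_inl]; rfl
  | peek k f q ih =>
    simp only [liftFst, TM2.stepAux]
    rw [← ih]; rfl
  | pop k f q ih =>
    simp only [liftFst, TM2.stepAux]
    rw [← ih, ← update_compStk_inl]; rfl
  | load f q ih =>
    simp only [liftFst, TM2.stepAux]
    rw [← ih]
  | branch f q₁ q₂ ih₁ ih₂ =>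
    simp only [liftFst, TM2.stepAux]
    cases f v
    · exact ih₂ _ _
    · exact ih₁ _ _
  | goto f => rfl
  | halt => rfl

theorem stepAux_liftSnd (q : TM2.Stmt tm₂.Γ tm₂.Λ tm₂.σ) (v : tm₂.σ) (v' : tm₁.σ) (r : Option Δ) :
    TM2.stepAux (liftSnd tm₁ tm₂ q) (v', v, r) (compStk tm₁ tm₂ S₁ S₂ l) =
      embSnd S₁ l v' r (TM2.stepAux q v S₂) := by
  induction q generalizing v S₂ with
  | push k f q ih =>
    simp only [liftSnd, TM2.stepAux]
    rw [← ih, ← update_compStk_inr]; rfl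
  | peek k f q ih =>
    simp only [liftSnd, TM2.stepAux]
    rw [← ih]; rfl
  | pop k f q ih =>
    simp only [liftSnd, TM2.stepAux]
    rw [← ih, ← update_compStk_inr]; rfl
  | load f q ih =>
    simp only [liftSnd, TM2.stepAux]
    rw [← ih]
  | branch f q₁ q₂ ih₁ ih₂ =>
    simp only [liftSnd, TM2.stepAux]
    cases f v
    · exact ih₂ _ _
    · exact ih₁ _ _
  | goto f => rfl
  | halt => rfl

end

theorem ReachesIn.map {K K' : Type} [DecidableEq K] [DecidableEq K'] {Γ : K → Type}
    {Γ' : K' → Type} {Λ Λ' σ σ' : Type} {M : Λ → TM2.Stmt Γ Λ σ} {M' : Λ' → TM2.Stmt Γ' Λ' σ'}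
    (φ : TM2.Cfg Γ Λ σ → TM2.Cfg Γ' Λ' σ')
    (hφ : ∀ a b, TM2.step M a = some b → TM2.step M' (φ a) = some (φ b))
    {a b : TM2.Cfg Γ Λ σ} {t : ℕ} (h : ReachesIn M a b t) : ReachesIn M' (φ a) (φ b) t := by
  obtain ⟨s, hs, h⟩ := h
  refine ⟨s, hs, ?_⟩
  clear hs
  induction s generalizing b with
  | zero =>
    obtain rfl : a = b := by simpa using h
    rfl
  | succ s ih =>
    rw [Function.iterate_succ_apply'] at h ⊢
    obtain ⟨c, hc, hcb⟩ := Option.bind_eq_some_iff.1 h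
    rw [ih hc]
    exact hφ _ _ hcb

theorem reachesIn_embFst (d : Δ) (S₂ : ∀ k, List (tm₂.Γ k)) (l : List Δ) (r : tm₂.σ × Option Δ)
    {a b : TM2.Cfg tm₁.Γ tm₁.Λ tm₁.σ} {t : ℕ} (h : ReachesIn tm₁.m a b t) :
    ReachesIn (compProgram e₁ e₂ d) (embFst S₂ l r a) (embFst S₂ l r b) t := by
  refine h.map _ fun a b hab => ?_
  obtain ⟨_ | x, v, S⟩ := a
  · simp at hab
  · simp only [TM2.step, Option.some.injEq] at hab
    subst hab
    exact congrArg some (stepAux_liftFst ..)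

theorem reachesIn_embSnd (d : Δ) (S₁ : ∀ k, List (tm₁.Γ k)) (l : List Δ) (v : tm₁.σ)
    (r : Option Δ) {a b : TM2.Cfg tm₂.Γ tm₂.Λ tm₂.σ} {t : ℕ} (h : ReachesIn tm₂.m a b t) :
    ReachesIn (compProgram e₁ e₂ d) (embSnd S₁ l v r a) (embSnd S₁ l v r b) t := by
  refine h.map _ fun a b hab => ?_
  obtain ⟨_ | x, v, S⟩ := a
  · simp at hab
  · simp only [TM2.step, Option.some.injEq] at hab
    subst hab
    exact congrArg some (stepAux_liftSnd ..)

/-- Popping and pushing one symbol at a time reverses the string; the second transfer reverses it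
back. The default `d` is never written, because the push happens only when the register is filled.
-/
theorem reachesIn_moveToAux (d : Δ) (S₁ : ∀ k, List (tm₁.Γ k)) (S₂ : ∀ k, List (tm₂.Γ k))
    (v : tm₁.σ) (w : tm₂.σ) (x l : List Δ) :
    ReachesIn (compProgram e₁ e₂ d)
      ⟨some (.inr (.inr false)), (v, w, none),
        compStk tm₁ tm₂ (Function.update S₁ tm₁.k₁ (x.map e₁.symm)) S₂ l⟩
      ⟨some (.inr (.inr true)), (v, w, none),
        compStk tm₁ tm₂ (Function.update S₁ tm₁.k₁ []) S₂ (x.reverse ++ l)⟩ (x.length + 1) := by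
  induction x generalizing l with
  | nil =>
    refine .single ?_
    simp only [TM2.step, compProgram, TM2.stepAux, update_compStk_inl]
    simp [compStk]
  | cons y x ih =>
    refine .head ?_ ((ih (y :: l)).mono le_rfl |> (by simpa using ·))
    simp only [TM2.step, compProgram, TM2.stepAux, update_compStk_inl]
    simp [compStk, update_compStk_none]

theorem reachesIn_moveFromAux (d : Δ) (S₁ : ∀ k, List (tm₁.Γ k)) (S₂ : ∀ k, List (tm₂.Γ k))
    (v : tm₁.σ) (w : tm₂.σ) (x l : List Δ) :
    ReachesIn (compProgram e₁ e₂ d)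
      ⟨some (.inr (.inr true)), (v, w, none),
        compStk tm₁ tm₂ S₁ (Function.update S₂ tm₂.k₀ (x.map e₂.symm)) l⟩
      ⟨some (.inr (.inl tm₂.main)), (v, w, none),
        compStk tm₁ tm₂ S₁ (Function.update S₂ tm₂.k₀ ((l.reverse ++ x).map e₂.symm)) []⟩
      (l.length + 1) := by
  induction l generalizing x with
  | nil =>
    refine .single ?_
    simp only [TM2.step, compProgram, TM2.stepAux, update_compStk_none]
    simp [compStk]
  | cons y l ih =>
    refine .head ?_ ((ih (y :: x)).mono le_rfl |> (by simpa using ·))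
    simp only [TM2.step, compProgram, TM2.stepAux, update_compStk_none]
    simp [compStk, update_compStk_inr]

theorem stk_initList (tm : FinTM2) (s : List (tm.Γ tm.k₀)) :
    (initList tm s).stk = Function.update (fun _ => []) tm.k₀ s := by
  funext k
  by_cases h : k = tm.k₀
  · subst h; simp [initList]
  · simp [initList, h]

theorem stk_haltList (tm : FinTM2) (s : List (tm.Γ tm.k₁)) :
    (haltList tm s).stk = Function.update (fun _ => []) tm.k₁ s := by
  funext k
  by_cases h : k = tm.k₁
  · subst h; simp [haltList]
  · simp [haltList, h]

theorem ReachesIn.length_output_le {tm : FinTM2} {B : ℕ} (hB : ∀ l, pushBound (tm.m l) ≤ B)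
    {x : List (tm.Γ tm.k₀)} {y : List (tm.Γ tm.k₁)} {t : ℕ}
    (h : ReachesIn tm.m (initList tm x) (haltList tm y) t) : y.length ≤ x.length + B * t := by
  have h' := h.length_le hB tm.k₁
  rw [stk_haltList, stk_initList, Function.update_self] at h'
  refine h'.trans (Nat.add_le_add_right ?_ _)
  -- The output stack may be the input stack; only then does it start nonempty.
  by_cases hk : tm.k₁ = tm.k₀
  · refine le_of_eq ?_
    generalize tm.k₁ = k at hk
    subst hk
    rw [Function.update_self]
  · rw [Function.update_of_ne hk]; simp

/-- The composed machine. -/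
noncomputable def compMachine (d : Δ) : FinTM2 :=
  letI := tm₁.kFin
  letI := tm₂.kFin
  letI := tm₁.ΛFin
  letI := tm₂.ΛFin
  letI := tm₁.σFin
  letI := tm₂.σFin
  letI := tm₁.Γk₀Fin
  letI := tm₂.Γk₀Fin
  letI : Fintype Δ := Fintype.ofEquiv _ e₂
  { K := Option (tm₁.K ⊕ tm₂.K)
    k₀ := some (.inl tm₁.k₀)
    k₁ := some (.inr tm₂.k₁)
    Γ := CompΓ tm₁ tm₂ Δ
    Λ := CompΛ tm₁ tm₂
    main := .inl tm₁.main
    σ := CompState tm₁ tm₂ Δ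
    initialState := (tm₁.initialState, tm₂.initialState, none)
    Γk₀Fin := tm₁.Γk₀Fin
    m := compProgram e₁ e₂ d }

theorem compStk_nil : compStk tm₁ tm₂ (fun _ => []) (fun _ => []) ([] : List Δ) = fun _ => [] := by
  funext k
  rcases k with _ | k | k <;> rfl

theorem initList_compMachine (d : Δ) (x : List (tm₁.Γ tm₁.k₀)) :
    initList (compMachine e₁ e₂ d) x =
      embFst (fun _ => []) [] (tm₂.initialState, none) (initList tm₁ x) := by
  have h : (initList (compMachine e₁ e₂ d) x).stk =
      compStk tm₁ tm₂ (initList tm₁ x).stk (fun _ => []) [] := by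
    refine (stk_initList (compMachine e₁ e₂ d) x).trans ?_
    rw [stk_initList, ← update_compStk_inl, compStk_nil]
    rfl
  exact congrArg (TM2.Cfg.mk _ _) h

theorem haltList_compMachine (d : Δ) (z : List (tm₂.Γ tm₂.k₁)) :
    haltList (compMachine e₁ e₂ d) z =
      embSnd (fun _ => []) [] tm₁.initialState none (haltList tm₂ z) := by
  have h : (haltList (compMachine e₁ e₂ d) z).stk =
      compStk tm₁ tm₂ (fun _ => []) (haltList tm₂ z).stk [] := by
    refine (stk_haltList (compMachine e₁ e₂ d) z).trans ?_
    rw [stk_haltList, ← update_compStk_inr, compStk_nil]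
    rfl
  exact congrArg (TM2.Cfg.mk _ _) h

/-- `haltList` prescribes the initial state and empty stacks apart from the output. Hence once the
output is transferred nothing remains of the first run, and the second machine starts exactly in its
`initList`. Each transfer costs `y.length + 1` steps. -/
theorem reachesIn_compMachine (d : Δ) {x : List (tm₁.Γ tm₁.k₀)} {y : List Δ}
    {z : List (tm₂.Γ tm₂.k₁)} {s t : ℕ}
    (h₁ : ReachesIn tm₁.m (initList tm₁ x) (haltList tm₁ (y.map e₁.symm)) s)
    (h₂ : ReachesIn tm₂.m (initList tm₂ (y.map e₂.symm)) (haltList tm₂ z) t) :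
    ReachesIn (compMachine e₁ e₂ d).m (initList (compMachine e₁ e₂ d) x)
      (haltList (compMachine e₁ e₂ d) z) (s + (2 * y.length + 2) + t) := by
  have h₁' := reachesIn_embFst e₁ e₂ d (fun _ => []) [] (tm₂.initialState, none) h₁
  have h₂' := reachesIn_embSnd e₁ e₂ d (fun _ => []) [] tm₁.initialState none h₂
  have h₃ := reachesIn_moveToAux e₁ e₂ d (fun _ => []) (fun _ => []) tm₁.initialState
    tm₂.initialState y []
  have h₄ := reachesIn_moveFromAux e₁ e₂ d (fun _ => []) (fun _ => []) tm₁.initialState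
    tm₂.initialState [] y.reverse
  rw [← stk_haltList] at h₃
  rw [List.reverse_reverse, List.append_nil, ← stk_initList tm₂ (y.map _)] at h₄
  simp only [Function.update_eq_self_iff.2, List.append_nil, List.map_nil,
    List.length_reverse] at h₃ h₄
  rw [initList_compMachine, haltList_compMachine]
  exact (((h₁'.trans h₃).trans h₄).trans h₂').mono (by omega)

end Composition

/-- The composition of polynomial-time computable functions is polynomial-time computable. -/
theorem PolyTimeComputable.comp {α β γ Γ Δ Θ : Type} [Inhabited Δ] {ea : α → List Γ}
    {eb : β → List Δ} {ec : γ → List Θ} {g : β → γ} {f : α → β} (hg : PolyTimeComputable eb ec g)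
    (hf : PolyTimeComputable ea eb f) : PolyTimeComputable ea ec (g ∘ f) := by
  obtain ⟨hg⟩ := hg
  obtain ⟨hf⟩ := hf
  have := hf.tm.ΛFin
  -- The intermediate string has length at most `X + B * hf.time`; this polynomial is substituted
  -- into the time bound of the second machine.
  obtain ⟨B, hB⟩ := exists_pushBound hf.tm.m
  have key : ∀ a, ReachesIn (compMachine hf.outputAlphabet hg.inputAlphabet default).m
      (Turing.initList (compMachine hf.outputAlphabet hg.inputAlphabet default)
        ((ea a).map hf.inputAlphabet.symm))
      (Turing.haltList (compMachine hf.outputAlphabet hg.inputAlphabet default)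
        ((ec (g (f a))).map hg.outputAlphabet.symm))
      ((hf.time + (2 * (.X + .C B * hf.time) + 2) +
        hg.time.comp (.X + .C B * hf.time)).eval (ea a).length) := by
    intro a
    have h₁ := reachesIn_of_evalsToInTime (hf.outputsFun a)
    have h₂ := reachesIn_of_evalsToInTime (hg.outputsFun (f a))
    have hlen := h₁.length_output_le hB
    refine (reachesIn_compMachine hf.outputAlphabet hg.inputAlphabet default h₁ h₂).mono ?_
    simp only [List.length_map] at hlen
    have := natPolynomial_eval_mono hg.time hlen
    simp only [Polynomial.eval_add, Polynomial.eval_mul, Polynomial.eval_comp, Polynomial.eval_X,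
      Polynomial.eval_C, Polynomial.eval_ofNat]
    omega
  exact ⟨{
    tm := compMachine hf.outputAlphabet hg.inputAlphabet default
    inputAlphabet := hf.inputAlphabet
    outputAlphabet := hg.outputAlphabet
    time := _
    outputsFun := fun a => (key a).evalsToInTime.some }⟩

/-! ### Adding a universal vertex in polynomial time -/

section AddUniversalVertex

open Turing

/-- The stacks of the machine that adds a universal vertex. -/
inductive AddStack
  /-- the input -/
  | inp
  /-- the output, reversed -/
  | rev
  /-- one mark for each row that has been read -/
  | cnt
  /-- the output -/
  | out
  deriving DecidableEq

instance : Fintype AddStack :=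
  ⟨{.inp, .rev, .cnt, .out}, fun x => by cases x <;> simp⟩

/-- The stack alphabets of the machine that adds a universal vertex. -/
abbrev AddΓ : AddStack → Type
  | .inp | .rev | .out => Option Bool
  | .cnt => Unit

/-- The labels of the machine that adds a universal vertex: extending the rows, writing the new row,
and reversing the output. -/
inductive AddLabel
  | rows | newRow | reverse
  deriving DecidableEq

instance : Fintype AddLabel :=
  ⟨{.rows, .newRow, .reverse}, fun x => by cases x <;> simp⟩

/-- The program that adds a universal vertex to an adjacency matrix. -/
def addProgram : AddLabel → TM2.Stmt AddΓ AddLabel (Option (Option Bool))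
  | .rows =>
    .pop .inp (fun _ x => x) <|
    .branch (fun s => s.isSome)
      (.branch (fun s => s.join.isSome)
        (.push .rev (fun s => s.join) <| .load (fun _ => none) <| .goto fun _ => .rows)
        (.push .rev (fun _ => some true) <| .push .rev (fun _ => none) <|
         .push .cnt (fun _ => ()) <| .load (fun _ => none) <| .goto fun _ => .rows))
      (.goto fun _ => .newRow)
  | .newRow =>
    .pop .cnt (fun _ x => x.map fun _ => none) <|
    .branch (fun s => s.isSome)
      (.push .rev (fun _ => some true) <| .load (fun _ => none) <| .goto fun _ => .newRow)
      (.push .rev (fun _ => some false) <| .push .rev (fun _ => none) <| .goto fun _ => .reverse)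
  | .reverse =>
    .pop .rev (fun _ x => x) <|
    .branch (fun s => s.isSome)
      (.push .out (fun s => s.join) <| .load (fun _ => none) <| .goto fun _ => .reverse)
      .halt

/-- The stacks of the machine that adds a universal vertex. -/
def addStk (i r : List (Option Bool)) (c : List Unit) (o : List (Option Bool)) :
    ∀ k, List (AddΓ k)
  | .inp => i
  | .rev => r
  | .cnt => c
  | .out => o

section
variable (i r o x : List (Option Bool)) (c y : List Unit)

theorem update_addStk_inp : Function.update (addStk i r c o) .inp x = addStk x r c o := by
  funext k; cases k <;> rfl

theorem update_addStk_rev : Function.update (addStk i r c o) .rev x = addStk i x c o := by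
  funext k; cases k <;> rfl

theorem update_addStk_cnt : Function.update (addStk i r c o) .cnt y = addStk i r y o := by
  funext k; cases k <;> rfl

theorem update_addStk_out : Function.update (addStk i r c o) .out x = addStk i r c x := by
  funext k; cases k <;> rfl

end

/-- What the machine makes of a symbol of the rows of the old matrix. -/
def extendRowEnd : Option Bool → List (Option Bool)
  | none => [some true, none]
  | some b => [some b]

theorem reachesIn_add_rows (l r : List (Option Bool)) (c : List Unit) :
    ReachesIn addProgram ⟨some .rows, none, addStk l r c []⟩
      ⟨some .newRow, none, addStk [] ((l.flatMap extendRowEnd).reverse ++ r)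
        (List.replicate (l.count none) () ++ c) []⟩ (l.length + 1) := by
  induction l generalizing r c with
  | nil =>
    refine .single ?_
    simp only [TM2.step, addProgram, TM2.stepAux, update_addStk_inp]
    simp [addStk]
  | cons a l ih =>
    rcases a with _ | b
    · refine .head (b := ⟨some .rows, none, addStk l (none :: some true :: r) (() :: c) []⟩) ?_ ?_
      · simp only [TM2.step, addProgram, TM2.stepAux, update_addStk_inp, update_addStk_rev,
          update_addStk_cnt]
        simp [addStk]
      · have := ih (none :: some true :: r) (() :: c)
        rw [List.append_cons (List.replicate _ _), ← List.replicate_succ'] at this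
        simpa [extendRowEnd] using this
    · refine .head (b := ⟨some .rows, none, addStk l (some b :: r) c []⟩) ?_ ?_
      · simp only [TM2.step, addProgram, TM2.stepAux, update_addStk_inp, update_addStk_rev]
        simp [addStk]
      · simpa [extendRowEnd] using ih (some b :: r) c

theorem reachesIn_add_newRow (r : List (Option Bool)) (n : ℕ) :
    ReachesIn addProgram ⟨some .newRow, none, addStk [] r (List.replicate n ()) []⟩
      ⟨some .reverse, none,
        addStk [] (none :: some false :: (List.replicate n (some true) ++ r)) [] []⟩ (n + 1) := by
  induction n generalizing r with
  | zero =>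
    refine .single ?_
    simp only [TM2.step, addProgram, TM2.stepAux, update_addStk_rev, update_addStk_cnt]
    simp [addStk]
  | succ n ih =>
    refine .head (b := ⟨some .newRow, none, addStk [] (some true :: r) (List.replicate n ()) []⟩)
      ?_ ?_
    · simp only [TM2.step, addProgram, TM2.stepAux, update_addStk_rev, update_addStk_cnt]
      simp [addStk, List.replicate_succ]
    · have := ih (some true :: r)
      rwa [List.append_cons, ← List.replicate_succ'] at this

theorem reachesIn_add_reverse (r o : List (Option Bool)) :
    ReachesIn addProgram ⟨some .reverse, none, addStk [] r [] o⟩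
      ⟨none, none, addStk [] [] [] (r.reverse ++ o)⟩ (r.length + 1) := by
  induction r generalizing o with
  | nil =>
    refine .single ?_
    simp only [TM2.step, addProgram, TM2.stepAux, update_addStk_rev]
    simp [addStk]
  | cons a r ih =>
    refine .head (b := ⟨some .reverse, none, addStk [] r [] (a :: o)⟩) ?_ (by simpa using ih (a :: o))
    simp only [TM2.step, addProgram, TM2.stepAux, update_addStk_rev, update_addStk_out]
    simp [addStk]

/-- The machine that adds a universal vertex. -/
def addMachine : FinTM2 where
  K := AddStack
  k₀ := .inp
  k₁ := .out
  Γ := AddΓ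
  Λ := AddLabel
  main := .rows
  σ := Option (Option Bool)
  initialState := none
  Γk₀Fin := inferInstanceAs (Fintype (Option Bool))
  m := addProgram

theorem reachesIn_addMachine (l : List (Option Bool)) :
    ReachesIn addMachine.m (initList addMachine l)
      (haltList addMachine (l.flatMap extendRowEnd ++
        (List.replicate (l.count none) (some true) ++ [some false, none]))) (5 * l.length + 5) := by
  have h₀ : initList addMachine l = ⟨some .rows, none, addStk l [] [] []⟩ := by
    refine congrArg (TM2.Cfg.mk _ _) ?_
    funext k; cases k <;> rfl
  have h₁ : ∀ o, haltList addMachine o = ⟨none, none, addStk [] [] [] o⟩ := by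
    intro o
    refine congrArg (TM2.Cfg.mk _ _) ?_
    funext k; cases k <;> rfl
  have hlen : (l.flatMap extendRowEnd).length ≤ 2 * l.length := by
    clear h₀
    induction l with
    | nil => simp
    | cons a l ih =>
      rw [List.flatMap_cons, List.length_append, List.length_cons]
      rcases a with _ | b <;> simp only [extendRowEnd, List.length_cons, List.length_nil] <;> omega
  have hcount : l.count none ≤ l.length := List.count_le_length
  have key := ((reachesIn_add_rows l [] []).trans <| by
    rw [List.append_nil, List.append_nil]
    exact reachesIn_add_newRow _ _).trans (reachesIn_add_reverse _ [])
  rw [h₀]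
  refine Eq.subst (motive := fun c => ReachesIn addProgram _ c _) (h₁ _).symm ?_
  have e : ∀ m (x : List (Option Bool)), (none :: some false :: (List.replicate m (some true) ++
      x.reverse)).reverse ++ [] = x ++ (List.replicate m (some true) ++ [some false, none]) := by
    intro m x
    simp
  rw [e] at key
  -- With `L = l.length`, the phases take `L + 1`, at most `L + 1` and at most `3 * L + 3` steps,
  -- since the string to be reversed has at most `2 * L + L + 2` symbols.
  refine key.mono ?_
  simp only [List.length_cons, List.length_append, List.length_replicate, List.length_reverse]
  omega

theorem addUniversalVertex_adj_castSucc {n : ℕ} (G : SimpleGraph (Fin n)) {i j : Fin n} :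
    (addUniversalVertex G).Adj i.castSucc j.castSucc ↔ G.Adj i j := by
  simp only [addUniversalVertex, SimpleGraph.sup_adj, SimpleGraph.map_adj', SimpleGraph.fromRel_adj,
    Fin.castSucc_ne_last, Fin.castSucc_inj, or_self, and_false, or_false, ne_eq]
  exact ⟨fun ⟨_, _, _, h, h₁, h₂⟩ => h₁ ▸ h₂ ▸ h, fun h => ⟨h.ne, i, j, h, rfl, rfl⟩⟩

theorem addUniversalVertex_adj_last {n : ℕ} (G : SimpleGraph (Fin n)) {u : Fin (n + 1)} :
    (addUniversalVertex G).Adj (Fin.last n) u ↔ u ≠ Fin.last n := by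
  constructor
  · exact fun h => h.ne'
  · intro h
    simp [addUniversalVertex, h.symm]

/-- The new vertex is the last one, so each old row gains a final `true`. The number of row ends is
`n`, which yields the `n` entries `true` of the new row before its diagonal `false`. -/
theorem encodeGraph_addUniversalVertex {n : ℕ} (G : SimpleGraph (Fin n)) :
    encodeGraph ⟨n + 1, addUniversalVertex G⟩ = (encodeGraph ⟨n, G⟩).flatMap extendRowEnd ++
      (List.replicate ((encodeGraph ⟨n, G⟩).count none) (some true) ++ [some false, none]) := by
  classical
  have h₁ : ∀ i j : Fin n, (addUniversalVertex G).Adj i.castSucc j.castSucc ↔ G.Adj i j :=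
    fun i j => addUniversalVertex_adj_castSucc G
  have h₂ : ∀ i : Fin n, (addUniversalVertex G).Adj i.castSucc (Fin.last n) :=
    fun i => ((addUniversalVertex_adj_last G).2 (Fin.castSucc_ne_last i)).symm
  have hcount : (encodeGraph ⟨n, G⟩).count none = n := by
    rw [encodeGraph, List.count_flatMap]
    have : ∀ i : Fin n, (List.count none ∘ fun i : Fin n => (List.finRange n).map
        (fun j => some (decide (G.Adj i j))) ++ [none]) i = 1 := by
      intro i
      rw [Function.comp_apply, List.count_append, List.count_eq_zero.2 (by simp)]
      simp
    rw [List.map_congr_left fun i _ => this i]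
    simp
  rw [hcount, encodeGraph, encodeGraph, List.flatMap_assoc]
  simp only [List.finRange_succ_last, List.flatMap_append, List.flatMap_map, List.map_append,
    List.map_map, List.flatMap_singleton]
  congr 1
  · refine List.flatMap_congr fun i _ => ?_
    simp [h₁, h₂, extendRowEnd, Function.comp_def, ← List.map_eq_flatMap]
  · simp [(h₂ _).symm, Function.comp_def]

/-- Adding a universal vertex can be done in polynomial time. -/
theorem polyTimeComputable_addUniversalVertex :
    PolyTimeComputable encodeGraph encodeGraph
      (fun G : FinGraph => (⟨G.1 + 1, addUniversalVertex G.2⟩ : FinGraph)) := by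
  refine ⟨{
    tm := addMachine
    inputAlphabet := Equiv.refl _
    outputAlphabet := Equiv.refl _
    time := 5 * .X + 5
    outputsFun := fun G => (ReachesIn.evalsToInTime ?_).some }⟩
  simp only [Polynomial.eval_add, Polynomial.eval_mul, Polynomial.eval_X, Polynomial.eval_ofNat]
  have := reachesIn_addMachine (encodeGraph G)
  rw [← encodeGraph_addUniversalVertex] at this
  have e : ∀ l : List (Option Bool), l.map (Equiv.refl (Option Bool)).invFun = l := List.map_id
  have h := e (encodeGraph G)
  have h' := e (encodeGraph ⟨G.1 + 1, addUniversalVertex G.2⟩)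
  exact Eq.mp (congrArg₂ (fun x y => ReachesIn addMachine.m (initList addMachine x)
    (haltList addMachine y) (5 * (encodeGraph G).length + 5)) h.symm h'.symm) this

end AddUniversalVertex

/-! ### Greedy colorings -/

section Greedy

variable {V : Type*} {G : SimpleGraph V} {n : ℕ} {v : Fin n ≃ V} {f : V → ℕ}

theorem IsGreedyColoring.ne (hf : IsGreedyColoring G v f) {u w : V} (h : G.Adj u w) :
    f u ≠ f w := by
  obtain ⟨i, rfl⟩ := v.surjective u
  obtain ⟨j, rfl⟩ := v.surjective w
  rcases lt_trichotomy i j with hij | rfl | hij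
  · exact (hf j).1.2 i hij h
  · exact absurd rfl h.ne
  · exact ((hf i).1.2 j hij h.symm).symm

theorem IsGreedyColoring.one_le (hf : IsGreedyColoring G v f) (u : V) : 1 ≤ f u := by
  obtain ⟨i, rfl⟩ := v.surjective u
  exact (hf i).1.1

theorem IsGreedyColoring.exists_of_lt (hf : IsGreedyColoring G v f) (i : Fin n) {c : ℕ}
    (hc : 1 ≤ c) (hci : c < f (v i)) : ∃ j < i, G.Adj (v j) (v i) ∧ f (v j) = c := by
  by_contra! h
  exact absurd ((hf i).2 ⟨hc, h⟩) (by omega)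

theorem IsGreedyColoring.finite_range (_ : IsGreedyColoring G v f) : (Set.range f).Finite := by
  have := Finite.of_equiv _ v
  exact Set.finite_range f

/-- A vertex of color `f u` sees every smaller color, so all of `1, …, f u` occur. -/
theorem IsGreedyColoring.le_ncard_range (hf : IsGreedyColoring G v f) (u : V) :
    f u ≤ (Set.range f).ncard := by
  have h : (Finset.Icc 1 (f u) : Set ℕ) ⊆ Set.range f := by
    intro c hc
    rw [Finset.coe_Icc, Set.mem_Icc] at hc
    obtain ⟨i, rfl⟩ := v.surjective u
    rcases hc.2.eq_or_lt with rfl | hlt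
    · exact ⟨_, rfl⟩
    · obtain ⟨j, -, -, rfl⟩ := hf.exists_of_lt i hc.1 hlt
      exact ⟨_, rfl⟩
  simpa using Set.ncard_le_ncard h hf.finite_range

theorem ncard_range_le {k : ℕ} (h₁ : ∀ u, 1 ≤ f u) (h : ∀ u, f u ≤ k) :
    (Set.range f).ncard ≤ k := by
  have h' : Set.range f ⊆ (Finset.Icc 1 k : Set ℕ) := by
    rintro _ ⟨u, rfl⟩
    simpa using ⟨h₁ u, h u⟩
  simpa using Set.ncard_le_ncard h' (Finset.finite_toSet _)

theorem exists_isGreedyColoring (G : SimpleGraph V) (v : Fin n ≃ V) :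
    ∃ f, IsGreedyColoring G v f := by
  let F : ∀ i : Fin n, (∀ j, j < i → ℕ) → ℕ := fun i ih =>
    sInf {c | 1 ≤ c ∧ ∀ (j) (hj : j < i), G.Adj (v j) (v i) → ih j hj ≠ c}
  let h : Fin n → ℕ := (wellFounded_lt (α := Fin n)).fix F
  have hh : ∀ i, h i = sInf {c | 1 ≤ c ∧ ∀ j < i, G.Adj (v j) (v i) → h j ≠ c} :=
    fun i => (wellFounded_lt (α := Fin n)).fix_eq F i
  refine ⟨h ∘ v.symm, fun i => ?_⟩
  simp only [Function.comp_apply, Equiv.symm_apply_apply]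
  have hne : {c | 1 ≤ c ∧ ∀ j < i, G.Adj (v j) (v i) → h j ≠ c}.Nonempty := by
    -- One more than the sum of all colors exceeds each of them, so it is free.
    refine ⟨∑ j, h j + 1, by omega, fun j _ _ hj => ?_⟩
    have := Finset.single_le_sum (f := h) (fun _ _ => Nat.zero_le _) (Finset.mem_univ j)
    omega
  rw [hh i]
  exact ⟨Nat.sInf_mem hne, fun c hc => Nat.sInf_le hc⟩

/-- Along an ordering by non-decreasing colors, the greedy algorithm uses no larger colors. -/
theorem IsGreedyColoring.le_of_monotone (hf : IsGreedyColoring G v f) {g : V → ℕ}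
    (hg : ∀ u w, G.Adj u w → g u ≠ g w) (hv : Monotone (g ∘ v)) (u : V) : f u ≤ g u + 1 := by
  obtain ⟨i, rfl⟩ := v.surjective u
  induction i using WellFoundedLT.induction with
  | ind i ih =>
    -- The color `g (v i) + 1` is free: an earlier neighbour has strictly smaller `g`, so by
    -- induction its color is at most `g (v i)`.
    refine (hf i).2 ⟨by omega, fun j hj hadj => ?_⟩
    have h₁ := ih j hj
    have h₂ : g (v j) ≤ g (v i) := hv hj.le
    have h₃ := hg _ _ hadj
    omega

theorem connectedChromaticNumber_le_iff (G : SimpleGraph V) (k : ℕ) :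
    connectedChromaticNumber G ≤ k ↔ ∃ j ≤ k, HasConnectedGreedyColoring G j := by
  constructor
  · intro h
    by_contra! h'
    have : ((k + 1 : ℕ) : ℕ∞) ≤ connectedChromaticNumber G := by
      refine le_iInf₂ fun j hj => ?_
      by_contra! hlt
      refine h' j ?_ hj
      have := Nat.cast_lt.1 hlt
      omega
    have := Nat.cast_le.1 (this.trans h)
    omega
  · rintro ⟨j, hj, h⟩
    exact (iInf₂_le j h).trans (by exact_mod_cast hj)

theorem exists_equiv_monotone {n : ℕ} (g : Fin n → ℕ) : ∃ v : Fin n ≃ Fin n, Monotone (g ∘ v) :=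
  ⟨Tuple.sort g, Tuple.monotone_sort g⟩

end Greedy

/-! ### The connected chromatic number of a graph with a universal vertex -/

section UniversalVertex

variable {n : ℕ} (G : SimpleGraph (Fin n))

theorem addUniversalVertex_connected : (addUniversalVertex G).Connected := by
  rw [SimpleGraph.connected_iff_exists_forall_reachable]
  refine ⟨Fin.last n, fun u => ?_⟩
  by_cases h : u = Fin.last n
  · rw [h]
  · exact ((addUniversalVertex_adj_last G).2 h).reachable

/-- Removing the color of the universal vertex from the palette still leaves a proper coloring of
`G`. Connectedness of the ordering plays no role. -/
theorem chromaticNumber_add_one_le_of_hasConnectedGreedyColoring {k : ℕ}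
    (h : HasConnectedGreedyColoring (addUniversalVertex G) k) :
    G.chromaticNumber + 1 ≤ (k : ℕ∞) := by
  obtain ⟨m, v, f, -, hf, rfl⟩ := h
  have hfin := hf.finite_range
  let s : Set ℕ := Set.range f \ {f (Fin.last n)}
  have hs : s.Finite := hfin.sdiff
  have : Fintype s := hs.fintype
  have hC : G.Colorable (Fintype.card s) := (SimpleGraph.Coloring.mk
    (fun i => (⟨f i.castSucc, ⟨_, rfl⟩, fun h => hf.ne ((addUniversalVertex_adj_last G).2
      (Fin.castSucc_ne_last i)) h.symm⟩ : s))
    (fun {i j} hij h => hf.ne ((addUniversalVertex_adj_castSucc G).2 hij)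
      (congrArg Subtype.val h))).colorable
  have hcard : Fintype.card s + 1 = (Set.range f).ncard := by
    rw [← Set.ncard_sdiff_singleton_add_one (Set.mem_range_self (Fin.last n)) hfin,
      ← Nat.card_eq_fintype_card]
    rfl
  rw [← hcard, Nat.cast_add, Nat.cast_one]
  gcongr
  exact hC.chromaticNumber_le

/-- The universal vertex gets class `0` and the classes of `G` are shifted by one. Sorting by class
then gives a connected ordering on which `IsGreedyColoring.le_of_monotone` bounds the colors. -/
theorem connectedChromaticNumber_addUniversalVertex_le {k : ℕ} (h : G.Colorable k) :
    connectedChromaticNumber (addUniversalVertex G) ≤ ((k + 1 : ℕ) : ℕ∞) := by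
  obtain ⟨C⟩ := h
  let g : Fin (n + 1) → ℕ := Fin.lastCases 0 fun i => (C i : ℕ) + 1
  have g_last : g (Fin.last n) = 0 := by simp [g]
  have g_castSucc : ∀ i, g (Fin.castSucc i) = C i + 1 := fun i => by simp [g]
  have hg : ∀ u w, (addUniversalVertex G).Adj u w → g u ≠ g w := by
    intro u w huw
    cases u using Fin.lastCases with
    | last =>
      cases w using Fin.lastCases with
      | last => exact absurd rfl huw.ne
      | cast j => rw [g_last, g_castSucc]; omega
    | cast i =>
      cases w using Fin.lastCases with
      | last => rw [g_last, g_castSucc]; omega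
      | cast j =>
        have := C.valid ((addUniversalVertex_adj_castSucc G).1 huw)
        rw [g_castSucc, g_castSucc]
        exact fun h => this (Fin.ext (by omega))
  have hgk : ∀ u, g u ≤ k := by
    intro u
    cases u using Fin.lastCases with
    | last => rw [g_last]; omega
    | cast i => rw [g_castSucc]; exact (C i).2
  have hg0 : ∀ u, g u = 0 → u = Fin.last n := by
    intro u
    cases u using Fin.lastCases with
    | last => exact fun _ => rfl
    | cast i => rw [g_castSucc]; omega
  obtain ⟨v, hv⟩ := exists_equiv_monotone g
  obtain ⟨f, hf⟩ := exists_isGreedyColoring (addUniversalVertex G) v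
  -- Only the universal vertex has `g = 0`, and a sorted ordering starts with the minimum.
  have hv0 : v 0 = Fin.last n := by
    refine hg0 _ (Nat.le_zero.1 ?_)
    have := hv (Fin.zero_le (v.symm (Fin.last n)))
    simpa [g_last] using this
  refine (connectedChromaticNumber_le_iff _ _).2
    ⟨(Set.range f).ncard, ncard_range_le hf.one_le fun u => ?_, _, v, f, fun i hi => ⟨0, hi, ?_⟩,
      hf, rfl⟩
  · exact (hf.le_of_monotone hg hv u).trans (Nat.succ_le_succ (hgk u))
  · rw [hv0, addUniversalVertex_adj_last, ← hv0]
    exact fun h => hi.ne' (congrArg Fin.val (v.injective h))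

theorem connectedChromaticNumber_addUniversalVertex :
    connectedChromaticNumber (addUniversalVertex G) = G.chromaticNumber + 1 := by
  refine le_antisymm ?_ (le_iInf₂ fun k hk =>
    chromaticNumber_add_one_le_of_hasConnectedGreedyColoring G hk)
  have hG := G.colorable_of_fintype
  have hne : G.chromaticNumber ≠ ⊤ := SimpleGraph.chromaticNumber_ne_top_iff_exists.2 ⟨_, hG⟩
  obtain ⟨c, hc⟩ := ENat.ne_top_iff_exists.1 hne
  rw [← hc]
  exact connectedChromaticNumber_addUniversalVertex_le G
    (SimpleGraph.chromaticNumber_le_iff_colorable.1 hc.ge)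

end UniversalVertex

/-! ### Certificates for the connected chromatic number -/

section Certificate

variable {V : Type*} {k : ℕ}

/-- The color `c` is the least one that is not in `S`. -/
def IsMex (c : Fin (k + 1)) (S : Finset (Fin (k + 1))) : Prop :=
  c ∉ S ∧ ∀ c' < c, c' ∈ S

instance (c : Fin (k + 1)) (S : Finset (Fin (k + 1))) : Decidable (IsMex c S) :=
  inferInstanceAs (Decidable (_ ∧ _))

variable (k) in
open Classical in
/-- The colors (residues of `m` modulo `k + 1`) of the neighbours of `v` at which `m` is at most
`m v`. -/
noncomputable def earlierColors [Fintype V] (G : SimpleGraph V) (m : V → ℕ) (v : V) :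
    Finset (Fin (k + 1)) :=
  (Finset.univ.filter fun u => G.Adj v u ∧ m u ≤ m v).image fun u => Fin.ofNat (k + 1) (m u)

variable (k) in
/-- The numbers `m v` encode a connected ordering and a greedy coloring of `G`: their residues
modulo `k + 1` are the colors, and their sizes yield the ordering. -/
def IsCertificate [Fintype V] (G : SimpleGraph V) (m : V → ℕ) : Prop :=
  (∀ v, IsMex (Fin.ofNat (k + 1) (m v)) (earlierColors k G m v)) ∧
    ∀ v w, earlierColors k G m v = ∅ → earlierColors k G m w = ∅ → v = w

theorem mem_earlierColors [Fintype V] {G : SimpleGraph V} {m : V → ℕ} {v : V} {c : Fin (k + 1)} :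
    c ∈ earlierColors k G m v ↔ ∃ u, G.Adj v u ∧ m u ≤ m v ∧ Fin.ofNat (k + 1) (m u) = c := by
  simp [earlierColors, and_assoc]

/-- Sorting the vertices by `m` gives the ordering, and the mex condition is the greedy rule with
colors shifted to start at `0`. Ties are harmless, as they occur only between non-adjacent vertices.
-/
theorem IsCertificate.connectedChromaticNumber_le {n : ℕ} {G : SimpleGraph (Fin n)}
    {m : Fin n → ℕ} (h : IsCertificate k G m) :
    connectedChromaticNumber G ≤ ((k + 1 : ℕ) : ℕ∞) := by
  obtain ⟨hmex, huniq⟩ := h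
  -- Equal numbers on adjacent vertices would give equal residues, against the mex condition. So the
  -- comparison `≤` in `earlierColors` is strict along edges.
  have hlt : ∀ {u w}, G.Adj w u → m u ≤ m w → m u < m w := by
    intro u w hadj hle
    refine lt_of_le_of_ne hle fun he => (hmex w).1 (mem_earlierColors.2 ⟨u, hadj, hle, ?_⟩)
    rw [he]
  obtain ⟨v, hv⟩ := exists_equiv_monotone m
  have hpos : ∀ {i j}, m (v i) < m (v j) → i < j := by
    intro i j hij
    by_contra! hji
    exact absurd (hv hji) (not_le.2 hij)
  refine (connectedChromaticNumber_le_iff _ _).2 ⟨_, ncard_range_le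
    (f := fun u => (Fin.ofNat (k + 1) (m u) : ℕ) + 1) (fun u => by omega)
    (fun u => (Fin.ofNat (k + 1) (m u)).2), _, v, _, fun i hi => ?_, fun i => ⟨⟨by omega, ?_⟩, ?_⟩,
    rfl⟩
  -- The first vertex has no earlier neighbour, so by uniqueness every other vertex has one.
  · have h0 : earlierColors k G m (v ⟨0, by omega⟩) = ∅ := by
      rw [Finset.eq_empty_iff_forall_notMem]
      intro c hc
      obtain ⟨u, hadj, hle, -⟩ := mem_earlierColors.1 hc
      obtain ⟨j, rfl⟩ := v.surjective u
      have := hpos (hlt hadj hle)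
      exact absurd this (by simp [Fin.lt_def])
    have hi' : (earlierColors k G m (v i)).Nonempty := by
      rw [Finset.nonempty_iff_ne_empty]
      intro he
      have := v.injective (huniq _ _ he h0)
      rw [this] at hi
      exact lt_irrefl _ hi
    obtain ⟨c, hc⟩ := hi'
    obtain ⟨u, hadj, hle, -⟩ := mem_earlierColors.1 hc
    obtain ⟨j, rfl⟩ := v.surjective u
    exact ⟨j, hpos (hlt hadj hle), hadj.symm⟩
  · intro j hj hadj he
    refine (hmex (v i)).1 (mem_earlierColors.2 ⟨v j, hadj.symm, hv hj.le, Fin.ext ?_⟩)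
    omega
  · rintro c ⟨hc, hne⟩
    by_contra! hlt'
    have hck : c - 1 < k + 1 := by
      have := (Fin.ofNat (k + 1) (m (v i))).2
      omega
    have := (hmex (v i)).2 ⟨c - 1, hck⟩ (by rw [Fin.lt_def]; dsimp only; omega)
    obtain ⟨u, hadj, hle, he⟩ := mem_earlierColors.1 this
    obtain ⟨j, rfl⟩ := v.surjective u
    refine hne j (hpos (hlt hadj hle)) hadj.symm ?_
    rw [he]
    dsimp only
    omega

theorem exists_isCertificate {n : ℕ} {G : SimpleGraph (Fin n)}
    (h : connectedChromaticNumber G ≤ ((k + 1 : ℕ) : ℕ∞)) :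
    ∃ m : Fin n → ℕ, (∀ v, m v < n * (k + 1)) ∧ IsCertificate k G m := by
  obtain ⟨j, hj, n', v, f, hv, hf, rfl⟩ := (connectedChromaticNumber_le_iff _ _).1 h
  obtain rfl : n' = n := by simpa using Fintype.card_congr v
  have hf1 := hf.one_le
  have hfk : ∀ u, f u - 1 < k + 1 := by
    intro u
    have := hf.le_ncard_range u
    have := hf1 u
    omega
  -- Position and color as the two digits in base `k + 1`; the position is the leading digit, so `m`
  -- orders the vertices as `v` does.
  let m : Fin n' → ℕ := fun u => (v.symm u : ℕ) * (k + 1) + (f u - 1)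
  have hmod : ∀ u, (Fin.ofNat (k + 1) (m u) : ℕ) = f u - 1 := by
    intro u
    simp only [m, Fin.ofNat]
    rw [Nat.mul_add_mod', Nat.mod_eq_of_lt (hfk u)]
  have hlt : ∀ u w, v.symm u < v.symm w → m u < m w := by
    intro u w huw
    have h₁ : ((v.symm u : ℕ) + 1) * (k + 1) ≤ v.symm w * (k + 1) :=
      Nat.mul_le_mul_right _ huw
    have := hfk u
    simp only [m]
    rw [add_mul] at h₁
    omega
  have hmem : ∀ {w : Fin n'} {c : Fin (k + 1)}, c ∈ earlierColors k G m w ↔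
      ∃ u, G.Adj u w ∧ v.symm u < v.symm w ∧ f u - 1 = c := by
    intro w c
    rw [mem_earlierColors]
    refine exists_congr fun u => ?_
    rw [G.adj_comm w u]
    refine and_congr_right fun hadj => and_congr ?_ ?_
    · constructor
      · intro hle
        by_contra! hge
        rcases hge.eq_or_lt with he | hlt'
        · exact hadj.ne (v.symm.injective he.symm)
        · exact absurd (hlt _ _ hlt') (not_lt.2 hle)
      · exact fun h => (hlt _ _ h).le
    · rw [Fin.ext_iff, hmod]
  refine ⟨m, fun u => ?_, fun w => ⟨fun hw => ?_, fun c hc => ?_⟩, ?_⟩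
  · have h₁ : ((v.symm u : ℕ) + 1) * (k + 1) ≤ n' * (k + 1) :=
      Nat.mul_le_mul_right _ (v.symm u).2
    have := hfk u
    simp only [m]
    rw [add_mul] at h₁
    omega
  · obtain ⟨u, hadj, -, he⟩ := hmem.1 hw
    rw [hmod] at he
    have := hf.ne hadj
    have := hf1 u
    have := hf1 w
    omega
  · rw [Fin.lt_def, hmod] at hc
    have hc' : (c : ℕ) + 1 < f (v (v.symm w)) := by rw [v.apply_symm_apply]; omega
    obtain ⟨j, hj, hadj, he⟩ := hf.exists_of_lt (v.symm w) (by omega) hc'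
    rw [v.apply_symm_apply] at hadj
    exact hmem.2 ⟨v j, hadj, by simpa using hj, by omega⟩
  · have hzero : ∀ w, earlierColors k G m w = ∅ → (v.symm w : ℕ) = 0 := by
      intro w hw
      by_contra hpos
      obtain ⟨j, hj, hadj⟩ := hv (v.symm w) (Nat.pos_of_ne_zero hpos)
      rw [v.apply_symm_apply] at hadj
      have : (⟨f (v j) - 1, hfk _⟩ : Fin (k + 1)) ∈ earlierColors k G m w :=
        hmem.2 ⟨v j, hadj, by simpa using hj, rfl⟩
      simp [hw] at this
    intro u w hu hw
    exact v.symm.injective (Fin.ext ((hzero u hu).trans (hzero w hw).symm))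

end Certificate

/-! ### Verifying certificates in polynomial time -/

section Verifier

open Turing

/-- The number that a string of bits starts with, in unary: the number of leading bits `true`. -/
def unaryHead : List Bool → ℕ
  | true :: w => unaryHead w + 1
  | _ => 0

/-- The string of bits after the first number (and the bit `false` that ends it). -/
def unaryTail : List Bool → List Bool
  | true :: w => unaryTail w
  | false :: w => w
  | [] => []

theorem unaryHead_le (w : List Bool) : unaryHead w ≤ w.length := by
  induction w with
  | nil => simp [unaryHead]
  | cons b w ih => cases b <;> simp [unaryHead, ih]

theorem length_unaryTail_le (w : List Bool) : (unaryTail w).length ≤ w.length := by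
  induction w with
  | nil => simp [unaryTail]
  | cons b w ih => cases b <;> simp [unaryTail]; omega

variable (k : ℕ)

/-- The colors among the first numbers of `w` that are at most `m` and selected by the bits of a
row of the adjacency matrix, together with those in `S`. -/
def rowColors (m : ℕ) : List Bool → List Bool → Finset (Fin (k + 1)) → Finset (Fin (k + 1))
  | [], _, S => S
  | b :: row, w, S => rowColors m row (unaryTail w)
      (if b && decide (unaryHead w ≤ m) then insert (Fin.ofNat (k + 1) (unaryHead w)) S else S)

/-- The verification of the certificate `w` for the rows of an adjacency matrix. The first numbers
of `d` belong to these rows; `ok` is the result so far, and `src` tells whether a vertex without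
earlier neighbours has been found. -/
def checkRows (w : List Bool) : List (List Bool) → List Bool → Bool → Bool → Bool
  | [], _, ok, _ => ok
  | row :: rows, d, ok, src =>
    let S := rowColors k (unaryHead d) row w ∅
    checkRows w rows (unaryTail d)
      (ok && decide (IsMex (Fin.ofNat (k + 1) (unaryHead d)) S) && !(src && decide (S = ∅)))
      (src || decide (S = ∅))

/-! ### The stack machine of the verifier -/

/-- The stacks of the verifier. -/
inductive VerStack
  /-- the input -/
  | inp
  /-- the adjacency matrix, reversed -/
  | mat
  /-- the certificate, reversed -/
  | vec
  /-- the part of the certificate that has been read, in the current row -/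
  | done
  /-- the part of the certificate that belongs to the remaining rows -/
  | diag
  /-- the number that belongs to the current row -/
  | num
  /-- the part of that number that has been compared with the current number -/
  | cmp
  /-- the output -/
  | out
  deriving DecidableEq

instance : Fintype VerStack :=
  ⟨{.inp, .mat, .vec, .done, .diag, .num, .cmp, .out}, fun x => by cases x <;> simp⟩

/-- The stack alphabets of the verifier. -/
abbrev VerΓ : VerStack → Type
  | .inp => Option Bool ⊕ Bool
  | .mat => Option Bool
  | .vec | .done | .diag | .out => Bool
  | .num | .cmp => Unit

/-- The labels of the verifier. -/
inductive VerLabel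
  /-- distributing the input to the stacks -/
  | load
  /-- starting a row -/
  | row
  /-- reading the number of the row -/
  | number
  /-- starting an entry of the row -/
  | entry
  /-- comparing the number of the row with the number of the entry -/
  | compare
  /-- restoring the number of the row -/
  | restoreNum
  /-- restoring the certificate at the end of the row -/
  | restoreVec
  /-- emptying the stacks at the end -/
  | clean
  deriving DecidableEq

instance : Fintype VerLabel :=
  ⟨{.load, .row, .number, .entry, .compare, .restoreNum, .restoreVec, .clean},
    fun x => by cases x <;> simp⟩

/-- The symbols that the verifier has read in the current step. -/
structure VerReg where
  /-- the symbol read from the input -/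
  inp : Option (Option Bool ⊕ Bool) := none
  /-- the symbol read from the matrix -/
  mat : Option (Option Bool) := none
  /-- the bit read from the certificate -/
  bit : Option Bool := none
  /-- whether there was a symbol on a further stack -/
  more : Bool := false

/-- The internal states of the verifier. -/
structure VerState where
  /-- the result so far -/
  ok : Bool := true
  /-- whether a vertex without earlier neighbours has been found -/
  src : Bool := false
  /-- the color of the current row -/
  color : Fin (k + 1) := 0
  /-- the colors of the earlier neighbours found in the current row -/
  S : Finset (Fin (k + 1)) := ∅
  /-- the current entry of the matrix -/
  adj : Bool := false
  /-- the color of the current entry -/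
  entryColor : Fin (k + 1) := 0
  /-- whether the number of the current entry exceeds that of the row -/
  exceeds : Bool := false
  /-- the symbols read in the current step -/
  reg : VerReg := {}

noncomputable instance : Fintype VerReg :=
  Fintype.ofInjective (fun r => (r.inp, r.mat, r.bit, r.more)) fun r s h => by
    cases r; cases s; simpa using h

noncomputable instance : Fintype (VerState k) :=
  Fintype.ofInjective
    (fun s => (s.ok, s.src, s.color, s.S, s.adj, s.entryColor, s.exceeds, s.reg)) fun r s h => by
    cases r; cases s; simpa using h

/-- The program of the verifier. -/
def verProgram : VerLabel → TM2.Stmt VerΓ VerLabel (VerState k)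
  | .load =>
    .pop .inp (fun s x => { s with reg.inp := x }) <|
    .branch (fun s => s.reg.inp.isSome)
      (.branch (fun s => (s.reg.inp.bind Sum.getLeft?).isSome)
        (.push .mat (fun s => (s.reg.inp.bind Sum.getLeft?).join) <|
         .load (fun s => { s with reg := {} }) <| .goto fun _ => .load)
        (.push .vec (fun s => (s.reg.inp.bind Sum.getRight?).getD false) <|
         .push .diag (fun s => (s.reg.inp.bind Sum.getRight?).getD false) <|
         .load (fun s => { s with reg := {} }) <| .goto fun _ => .load))
      (.goto fun _ => .row)
  | .row =>
    .pop .mat (fun s x => { s with reg.mat := x }) <|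
    .branch (fun s => s.reg.mat.isSome)
      (.load (fun s => { s with reg := {} }) <| .goto fun _ => .number)
      (.goto fun _ => .clean)
  | .number =>
    .pop .diag (fun s x => { s with reg.bit := x }) <|
    .branch (fun s => s.reg.bit == some true)
      (.push .num (fun _ => ()) <|
       .load (fun s => { s with color := s.color + 1, reg := {} }) <| .goto fun _ => .number)
      (.load (fun s => { s with reg := {} }) <| .goto fun _ => .entry)
  | .entry =>
    .peek .mat (fun s x => { s with reg.mat := x }) <|
    .branch (fun s => s.reg.mat.join.isSome)
      (.pop .mat (fun s _ => s) <|
       .load (fun s => { s with adj := s.reg.mat.join.getD false, reg := {} }) <|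
       .goto fun _ => .compare)
      (.load (fun s =>
        { ok := s.ok && decide (IsMex s.color s.S) && !(s.src && decide (s.S = ∅))
          src := s.src || decide (s.S = ∅) }) <|
       .goto fun _ => .restoreVec)
  | .compare =>
    .pop .vec (fun s x => { s with reg.bit := x }) <|
    .branch (fun s => s.reg.bit == some true)
      (.push .done (fun _ => true) <|
       .pop .num (fun s x => { s with reg.more := x.isSome }) <|
       .branch (fun s => s.reg.more)
        (.push .cmp (fun _ => ()) <|
         .load (fun s => { s with entryColor := s.entryColor + 1, reg := {} }) <|
         .goto fun _ => .compare)
        (.load (fun s => { s with entryColor := s.entryColor + 1, exceeds := true, reg := {} }) <|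
         .goto fun _ => .compare))
      (.branch (fun s => s.reg.bit.isSome)
        (.push .done (fun _ => false) <|
         .load (fun s => { s with
            S := if s.adj && !s.exceeds then insert s.entryColor s.S else s.S
            adj := false, entryColor := 0, exceeds := false, reg := {} }) <|
         .goto fun _ => .restoreNum)
        (.load (fun s => { s with
            S := if s.adj && !s.exceeds then insert s.entryColor s.S else s.S
            adj := false, entryColor := 0, exceeds := false, reg := {} }) <|
         .goto fun _ => .restoreNum))
  | .restoreNum =>
    .pop .cmp (fun s x => { s with reg.more := x.isSome }) <|
    .branch (fun s => s.reg.more)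
      (.push .num (fun _ => ()) <|
       .load (fun s => { s with reg := {} }) <| .goto fun _ => .restoreNum)
      (.goto fun _ => .entry)
  | .restoreVec =>
    .pop .done (fun s x => { s with reg.bit := x }) <|
    .pop .num (fun s x => { s with reg.more := x.isSome }) <|
    .branch (fun s => s.reg.bit.isSome)
      (.push .vec (fun s => s.reg.bit.getD false) <|
       .load (fun s => { s with reg := {} }) <| .goto fun _ => .restoreVec)
      (.branch (fun s => s.reg.more)
        (.load (fun s => { s with reg := {} }) <| .goto fun _ => .restoreVec)
        (.goto fun _ => .row))
  | .clean =>
    .pop .vec (fun s x => { s with reg.bit := x }) <|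
    .pop .diag (fun s x => { s with reg.more := x.isSome }) <|
    .branch (fun s => s.reg.bit.isSome || s.reg.more)
      (.load (fun s => { s with reg := {} }) <| .goto fun _ => .clean)
      (.push .out (fun s => s.ok) <| .load (fun _ => {}) .halt)

/-- The stacks of the verifier. -/
def verStk (i : List (Option Bool ⊕ Bool)) (a : List (Option Bool)) (b c d : List Bool)
    (r q : List Unit) (o : List Bool) : ∀ k, List (VerΓ k)
  | .inp => i
  | .mat => a
  | .vec => b
  | .done => c
  | .diag => d
  | .num => r
  | .cmp => q
  | .out => o

section
variable (i i' : List (Option Bool ⊕ Bool)) (a a' : List (Option Bool)) (b c d b' : List Bool)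
    (r q r' : List Unit) (o : List Bool)

theorem update_verStk_inp :
    Function.update (verStk i a b c d r q o) .inp i' = verStk i' a b c d r q o := by
  funext k; cases k <;> rfl

theorem update_verStk_mat :
    Function.update (verStk i a b c d r q o) .mat a' = verStk i a' b c d r q o := by
  funext k; cases k <;> rfl

theorem update_verStk_vec :
    Function.update (verStk i a b c d r q o) .vec b' = verStk i a b' c d r q o := by
  funext k; cases k <;> rfl

theorem update_verStk_done :
    Function.update (verStk i a b c d r q o) .done b' = verStk i a b b' d r q o := by
  funext k; cases k <;> rfl

theorem update_verStk_diag :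
    Function.update (verStk i a b c d r q o) .diag b' = verStk i a b c b' r q o := by
  funext k; cases k <;> rfl

theorem update_verStk_num :
    Function.update (verStk i a b c d r q o) .num r' = verStk i a b c d r' q o := by
  funext k; cases k <;> rfl

theorem update_verStk_cmp :
    Function.update (verStk i a b c d r q o) .cmp r' = verStk i a b c d r r' o := by
  funext k; cases k <;> rfl

theorem update_verStk_out :
    Function.update (verStk i a b c d r q o) .out b' = verStk i a b c d r q b' := by
  funext k; cases k <;> rfl

end

/-! ### Runs of the verifier and their time bounds -/

theorem reachesIn_ver_load_mat (x : List (Option Bool)) (i : List (Option Bool ⊕ Bool))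
    (a : List (Option Bool)) (b d : List Bool) :
    ReachesIn (verProgram k) ⟨some .load, {}, verStk (x.map Sum.inl ++ i) a b [] d [] [] []⟩
      ⟨some .load, {}, verStk i (x.reverse ++ a) b [] d [] [] []⟩ x.length := by
  induction x generalizing a with
  | nil => exact .refl _ _
  | cons y x ih =>
    refine .head (b := ⟨some .load, {}, verStk (x.map Sum.inl ++ i) (y :: a) b [] d [] [] []⟩) ?_
      (by simpa using ih (y :: a))
    simp only [TM2.step, verProgram, TM2.stepAux, update_verStk_inp, update_verStk_mat]
    simp [verStk]

theorem reachesIn_ver_load_vec (y : List Bool) (a : List (Option Bool)) (b d : List Bool) :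
    ReachesIn (verProgram k) ⟨some .load, {}, verStk (y.map Sum.inr) a b [] d [] [] []⟩
      ⟨some .row, {}, verStk [] a (y.reverse ++ b) [] (y.reverse ++ d) [] [] []⟩
      (y.length + 1) := by
  induction y generalizing b d with
  | nil =>
    refine .single ?_
    simp only [TM2.step, verProgram, TM2.stepAux, update_verStk_inp]
    simp [verStk]
  | cons x y ih =>
    refine .head (b := ⟨some .load, {}, verStk (y.map Sum.inr) a (x :: b) [] (x :: d) [] [] []⟩) ?_
      (by simpa using ih (x :: b) (x :: d))
    simp only [TM2.step, verProgram, TM2.stepAux, update_verStk_inp, update_verStk_vec,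
      update_verStk_diag]
    simp [verStk]

/-- The number is unbounded and goes to a stack in unary; its residue is counted along in the state.
-/
theorem reachesIn_ver_number (ok src : Bool) (j : Fin (k + 1)) (a : List (Option Bool))
    (b d : List Bool) (r : List Unit) :
    ReachesIn (verProgram k)
      ⟨some .number, { ok := ok, src := src, color := j }, verStk [] a b [] d r [] []⟩
      ⟨some .entry, { ok := ok, src := src, color := j + Fin.ofNat (k + 1) (unaryHead d) },
        verStk [] a b [] (unaryTail d) (List.replicate (unaryHead d) () ++ r) [] []⟩
      (d.length + 1) := by
  induction d generalizing j r with
  | nil =>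
    refine .single ?_
    simp only [TM2.step, verProgram, TM2.stepAux, update_verStk_diag]
    simp [verStk, unaryHead, unaryTail]
  | cons x d ih =>
    cases x
    · refine ReachesIn.mono (.single ?_) (by simp : 1 ≤ _)
      simp only [TM2.step, verProgram, TM2.stepAux, update_verStk_diag]
      simp [verStk, unaryHead, unaryTail]
    · refine .head (b := ⟨some .number, { ok := ok, src := src, color := j + 1 },
        verStk [] a b [] d (() :: r) [] []⟩) ?_ ?_
      · simp only [TM2.step, verProgram, TM2.stepAux, update_verStk_diag, update_verStk_num]
        simp [verStk]
      · have := ih (j + 1) (() :: r)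
        have e : j + 1 + Fin.ofNat (k + 1) (unaryHead d) =
            j + Fin.ofNat (k + 1) (unaryHead d + 1) := by
          ext; simp [Fin.val_add, Fin.ofNat, Nat.add_assoc, Nat.add_comm 1]
        rw [e, List.append_cons (List.replicate _ _), ← List.replicate_succ'] at this
        simpa [unaryHead, unaryTail] using this

/-- Each leading bit `true` of the certificate is matched with one mark on `num`; running out of
marks sets `exceeds`. The two equations say that nothing is lost: the certificate is split between
`vec` and `done`, the number of the row between `num` and `cmp`. An exhausted certificate reads as
`0` and moves no end bit, hence the existential form. -/
theorem reachesIn_ver_compare (ok src adj x : Bool) (j e : Fin (k + 1)) (S : Finset (Fin (k + 1)))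
    (a : List (Option Bool)) (b c d : List Bool) (p s : ℕ) :
    ∃ c' p' s', c'.reverse ++ unaryTail b = c.reverse ++ b ∧ p' + s' = p + s ∧
      ReachesIn (verProgram k)
        ⟨some .compare, {
            ok := ok, src := src, color := j, S := S, adj := adj, entryColor := e
            exceeds := x }, verStk [] a b c d (List.replicate p ()) (List.replicate s ()) []⟩
        ⟨some .restoreNum, {
            ok := ok, src := src, color := j
            S := if adj && !(x || decide (p < unaryHead b)) then
              insert (e + Fin.ofNat (k + 1) (unaryHead b)) S else S },
          verStk [] a (unaryTail b) c' d (List.replicate p' ()) (List.replicate s' ()) []⟩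
        (b.length + 1) := by
  induction b generalizing x e c p s with
  | nil =>
    refine ⟨c, p, s, rfl, rfl, .single ?_⟩
    simp only [TM2.step, verProgram, TM2.stepAux, update_verStk_vec]
    simp [verStk, unaryHead, unaryTail]
  | cons y b ih =>
    cases y
    · refine ⟨false :: c, p, s, by simp [unaryTail], rfl, ReachesIn.mono (.single ?_)
        (by simp : 1 ≤ _)⟩
      simp only [TM2.step, verProgram, TM2.stepAux, update_verStk_vec, update_verStk_done]
      simp [verStk, unaryHead, unaryTail]
    · have he : e + 1 + Fin.ofNat (k + 1) (unaryHead b) =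
          e + Fin.ofNat (k + 1) (unaryHead b + 1) := by
        ext; simp [Fin.val_add, Fin.ofNat, Nat.add_assoc, Nat.add_comm 1]
      cases p with
      | zero =>
        obtain ⟨c', p', s', hc, hps, h⟩ := ih true (e + 1) (true :: c) 0 s
        rw [he] at h
        refine ⟨c', p', s', by simpa [unaryTail] using hc, hps, .head ?_
          (by simpa [unaryHead, unaryTail] using h)⟩
        simp only [TM2.step, verProgram, TM2.stepAux, update_verStk_vec, update_verStk_done,
          update_verStk_num]
        simp [verStk]
      | succ p =>
        obtain ⟨c', p', s', hc, hps, h⟩ := ih x (e + 1) (true :: c) p (s + 1)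
        rw [he] at h
        refine ⟨c', p', s', by simpa [unaryTail] using hc, by omega, .head ?_
          (by simpa [unaryHead, unaryTail] using h)⟩
        simp only [TM2.step, verProgram, TM2.stepAux, update_verStk_vec, update_verStk_done,
          update_verStk_num, update_verStk_cmp]
        simp [verStk, List.replicate_succ]

theorem reachesIn_ver_restoreNum (v : VerState k) (hv : v.reg = {}) (a : List (Option Bool))
    (b c d : List Bool) (p s : ℕ) :
    ReachesIn (verProgram k)
      ⟨some .restoreNum, v, verStk [] a b c d (List.replicate p ()) (List.replicate s ()) []⟩
      ⟨some .entry, v, verStk [] a b c d (List.replicate (p + s) ()) [] []⟩ (s + 1) := by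
  obtain ⟨ok, src, j, S, adj, e, x, reg⟩ := v
  subst hv
  induction s generalizing p with
  | zero =>
    refine .single ?_
    simp only [TM2.step, verProgram, TM2.stepAux, update_verStk_cmp]
    simp [verStk]
  | succ s ih =>
    refine .head ?_ (by simpa [Nat.add_right_comm, Nat.add_assoc] using ih (p + 1))
    simp only [TM2.step, verProgram, TM2.stepAux, update_verStk_cmp, update_verStk_num]
    simp [verStk, List.replicate_succ]

/-- One entry costs one step to read it, at most `N + 1` to compare and at most `N + 1` to restore
the number. -/
theorem reachesIn_ver_entries (ok src : Bool) (j : Fin (k + 1)) (S : Finset (Fin (k + 1)))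
    (row : List Bool) (a : List (Option Bool)) (b c d : List Bool) (m N : ℕ)
    (hN : (c.reverse ++ b).length ≤ N) (hm : m ≤ N) :
    ∃ b' c', c'.reverse ++ b' = c.reverse ++ b ∧
      ReachesIn (verProgram k)
        ⟨some .entry, { ok := ok, src := src, color := j, S := S },
          verStk [] (row.map some ++ a) b c d (List.replicate m ()) [] []⟩
        ⟨some .entry, { ok := ok, src := src, color := j, S := rowColors k m row b S },
          verStk [] a b' c' d (List.replicate m ()) [] []⟩
        (row.length * (2 * N + 3)) := by
  induction row generalizing S b c with
  | nil => exact ⟨b, c, rfl, .refl _ _⟩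
  | cons y row ih =>
    obtain ⟨c₁, p, s, hc₁, hps, h₁⟩ := reachesIn_ver_compare k ok src y false j 0 S
      (row.map some ++ a) b c d m 0
    have h₂ := reachesIn_ver_restoreNum k {
          ok := ok, src := src, color := j
          S := if y && !(false || decide (m < unaryHead b)) then
            insert (0 + Fin.ofNat (k + 1) (unaryHead b)) S else S } rfl
      (row.map some ++ a) (unaryTail b) c₁ d p s
    rw [hps.trans (Nat.add_zero m)] at h₂
    obtain ⟨b', c', hc', h₃⟩ := ih (if y && !(false || decide (m < unaryHead b)) then
            insert (0 + Fin.ofNat (k + 1) (unaryHead b)) S else S) (unaryTail b) c₁ (hc₁ ▸ hN)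
    refine ⟨b', c', hc'.trans hc₁, ?_⟩
    have h₀ : TM2.step (verProgram k)
        ⟨some .entry, { ok := ok, src := src, color := j, S := S },
          verStk [] ((y :: row).map some ++ a) b c d (List.replicate m ()) [] []⟩ = some
        ⟨some .compare, { ok := ok, src := src, color := j, S := S, adj := y },
          verStk [] (row.map some ++ a) b c d (List.replicate m ()) [] []⟩ := by
      simp only [TM2.step, verProgram, TM2.stepAux, update_verStk_mat]
      simp [verStk]
    have e : rowColors k m (y :: row) b S = rowColors k m row (unaryTail b)
        (if y && !(false || decide (m < unaryHead b)) then
            insert (0 + Fin.ofNat (k + 1) (unaryHead b)) S else S) := by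
      simp [rowColors]
    rw [e]
    refine (((ReachesIn.head h₀ h₁).trans h₂).trans h₃).mono ?_
    rw [List.length_append] at hN
    rw [List.length_cons, Nat.add_one_mul row.length]
    omega

theorem reachesIn_ver_restoreVec (ok src : Bool) (a : List (Option Bool)) (b c d : List Bool)
    (m : ℕ) :
    ReachesIn (verProgram k)
      ⟨some .restoreVec, { ok := ok, src := src }, verStk [] a b c d (List.replicate m ()) [] []⟩
      ⟨some .row, { ok := ok, src := src }, verStk [] a (c.reverse ++ b) [] d [] [] []⟩
      (c.length + m + 1) := by
  induction c generalizing b m with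
  | nil =>
    induction m with
    | zero =>
      refine .single ?_
      simp only [TM2.step, verProgram, TM2.stepAux, update_verStk_done, update_verStk_num]
      simp [verStk]
    | succ m ih =>
      refine .head ?_ (ih.mono (by simp) : ReachesIn _ _ _ ([].length + m + 1))
      simp only [TM2.step, verProgram, TM2.stepAux, update_verStk_done, update_verStk_num]
      simp [verStk, List.replicate_succ]
  | cons x c ih =>
    -- Both stacks are popped in the same step; the truncated `m - 1` covers the case that `num` is
    -- already empty.
    refine .mono (.head ?_ (by simpa using ih (x :: b) (m - 1))) (by simp; omega)
    simp only [TM2.step, verProgram, TM2.stepAux, update_verStk_done, update_verStk_num,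
      update_verStk_vec]
    simp [verStk]

/-- Needed because `haltList` admits no leftover symbols and no state other than the initial one. -/
theorem reachesIn_ver_clean (ok src : Bool) (b d : List Bool) :
    ReachesIn (verProgram k)
      ⟨some .clean, { ok := ok, src := src }, verStk [] [] b [] d [] [] []⟩
      ⟨none, {}, verStk [] [] [] [] [] [] [] [ok]⟩ (b.length + d.length + 1) := by
  induction b generalizing d with
  | nil =>
    induction d with
    | nil =>
      refine .single ?_
      simp only [TM2.step, verProgram, TM2.stepAux, update_verStk_vec, update_verStk_diag,
        update_verStk_out]
      simp [verStk]
    | cons y d ih =>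
      refine .head ?_ (ih.mono (by simp) : ReachesIn _ _ _ ([].length + d.length + 1))
      simp only [TM2.step, verProgram, TM2.stepAux, update_verStk_vec, update_verStk_diag]
      simp [verStk]
  | cons x b ih =>
    refine .mono (.head ?_ (ih d.tail)) (by simp; omega)
    simp only [TM2.step, verProgram, TM2.stepAux, update_verStk_vec, update_verStk_diag]
    simp [verStk]

/-- An adjacency matrix on the stack of the verifier. -/
def matrixStack (rows : List (List Bool)) : List (Option Bool) :=
  rows.flatMap fun row => none :: row.map some

/-- The matrix is consumed, while the certificate `w` is restored after each row and `d` loses one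
number per row. The bound on `d'` is kept for the final cleaning. -/
theorem reachesIn_ver_rows (ok src : Bool) (rows : List (List Bool)) (w d : List Bool) (N : ℕ)
    (hw : w.length ≤ N) (hd : d.length ≤ N) (hrows : ∀ row ∈ rows, row.length ≤ N) :
    ∃ src' d', d'.length ≤ N ∧
      ReachesIn (verProgram k)
        ⟨some .row, { ok := ok, src := src }, verStk [] (matrixStack rows) w [] d [] [] []⟩
        ⟨some .clean, { ok := checkRows k w rows d ok src, src := src' },
          verStk [] [] w [] d' [] [] []⟩
        (rows.length * (2 * N * N + 6 * N + 4) + 1) := by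
  induction rows generalizing ok src d with
  | nil =>
    refine ⟨src, d, hd, .mono (.single ?_) (by simp : 1 ≤ _)⟩
    simp only [TM2.step, verProgram, TM2.stepAux, update_verStk_mat]
    simp [verStk, matrixStack, checkRows]
  | cons row rows ih =>
    have hm : unaryHead d ≤ N := (unaryHead_le d).trans hd
    obtain ⟨b', c', hc', h₂⟩ := reachesIn_ver_entries k ok src (Fin.ofNat (k + 1) (unaryHead d)) ∅
      row (matrixStack rows) w [] (unaryTail d) (unaryHead d) N (by simpa using hw) hm
    have h₁ := reachesIn_ver_number k ok src 0 (row.map some ++ matrixStack rows) w d []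
    rw [zero_add, List.append_nil] at h₁
    obtain ⟨src', d', hd', h₅⟩ := ih
      (ok && decide (IsMex (Fin.ofNat (k + 1) (unaryHead d)) (rowColors k (unaryHead d) row w ∅)) &&
        !(src && decide (rowColors k (unaryHead d) row w ∅ = ∅)))
      (src || decide (rowColors k (unaryHead d) row w ∅ = ∅)) (unaryTail d)
      ((length_unaryTail_le d).trans hd) (fun r hr => hrows r (List.mem_cons_of_mem _ hr))
    have h₄ := reachesIn_ver_restoreVec k
      (ok && decide (IsMex (Fin.ofNat (k + 1) (unaryHead d)) (rowColors k (unaryHead d) row w ∅)) &&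
        !(src && decide (rowColors k (unaryHead d) row w ∅ = ∅)))
      (src || decide (rowColors k (unaryHead d) row w ∅ = ∅)) (matrixStack rows) b' c'
      (unaryTail d) (unaryHead d)
    rw [hc', List.reverse_nil, List.nil_append] at h₄
    refine ⟨src', d', hd', ?_⟩
    have h₀ : TM2.step (verProgram k)
        ⟨some .row, { ok := ok, src := src },
          verStk [] (matrixStack (row :: rows)) w [] d [] [] []⟩ = some
        ⟨some .number, { ok := ok, src := src, color := 0 },
          verStk [] (row.map some ++ matrixStack rows) w [] d [] [] []⟩ := by
      simp only [TM2.step, verProgram, TM2.stepAux, update_verStk_mat]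
      simp [verStk, matrixStack]
    have h₃ : TM2.step (verProgram k)
        ⟨some .entry, {
            ok := ok, src := src, color := Fin.ofNat (k + 1) (unaryHead d)
            S := rowColors k (unaryHead d) row w ∅ },
          verStk [] (matrixStack rows) b' c' (unaryTail d) (List.replicate (unaryHead d) ()) []
            []⟩ = some
        ⟨some .restoreVec, {
            ok := ok && decide (IsMex (Fin.ofNat (k + 1) (unaryHead d))
              (rowColors k (unaryHead d) row w ∅)) &&
              !(src && decide (rowColors k (unaryHead d) row w ∅ = ∅))
            src := src || decide (rowColors k (unaryHead d) row w ∅ = ∅) },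
          verStk [] (matrixStack rows) b' c' (unaryTail d) (List.replicate (unaryHead d) ()) []
            []⟩ := by
      -- The row ends at the next marker or at the bottom of the stack; `join` treats both alike.
      have : (matrixStack rows).head?.join = none := by
        cases rows <;> simp [matrixStack]
      simp only [TM2.step, verProgram, TM2.stepAux]
      simp [verStk, this]
    refine ((((ReachesIn.head h₀ h₁).trans h₂).trans (.head h₃ h₄)).trans h₅).mono ?_
    have hrow := hrows row List.mem_cons_self
    have hlen : row.length * (2 * N + 3) ≤ N * (2 * N + 3) := Nat.mul_le_mul_right _ hrow
    have hc'' : c'.length ≤ N := by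
      have := congrArg List.length hc'
      simp at this
      omega
    rw [List.length_cons, Nat.add_one_mul rows.length]
    have : N * (2 * N + 3) = 2 * N * N + 3 * N := by ring
    omega

/-- The verifier. -/
noncomputable def verMachine : FinTM2 where
  K := VerStack
  k₀ := .inp
  k₁ := .out
  Γ := VerΓ
  Λ := VerLabel
  main := .load
  σ := VerState k
  initialState := {}
  Γk₀Fin := inferInstanceAs (Fintype (Option Bool ⊕ Bool))
  m := verProgram k

/-- Loading reverses the input, so the end marker of each row comes first, as in `matrixStack`, and
the certificate is read backwards. -/
theorem reachesIn_verMachine (x : List (Option Bool)) (y : List Bool) (rows : List (List Bool))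
    (hx : x.reverse = matrixStack rows) :
    ReachesIn (verMachine k).m (initList (verMachine k) (x.map Sum.inl ++ y.map Sum.inr))
      (haltList (verMachine k) [checkRows k y.reverse rows y.reverse true false])
      ((x.length + y.length) * (2 * (x.length + y.length) * (x.length + y.length) +
        6 * (x.length + y.length) + 4) + 4 * (x.length + y.length) + 3) := by
  have h₀ : ∀ i, initList (verMachine k) i = ⟨some .load, {}, verStk i [] [] [] [] [] [] []⟩ := by
    intro i
    refine congrArg (TM2.Cfg.mk _ _) ?_
    funext k; cases k <;> rfl
  have h₁ : ∀ o, haltList (verMachine k) o = ⟨none, {}, verStk [] [] [] [] [] [] [] o⟩ := by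
    intro o
    refine congrArg (TM2.Cfg.mk _ _) ?_
    funext k; cases k <;> rfl
  have hlen : x.length = (matrixStack rows).length := by rw [← hx, List.length_reverse]
  have hrows : rows.length ≤ x.length ∧ ∀ row ∈ rows, row.length ≤ x.length := by
    rw [hlen]
    clear hx hlen
    induction rows with
    | nil => simp
    | cons row rows ih =>
      have : (matrixStack (row :: rows)).length = row.length + 1 + (matrixStack rows).length := by
        simp [matrixStack]; omega
      rw [this]
      refine ⟨by simp; omega, fun r hr => ?_⟩
      rcases List.mem_cons.1 hr with rfl | hr
      · omega
      · have := ih.2 r hr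
        omega
  have h₂ := reachesIn_ver_load_mat k x (y.map Sum.inr) [] [] []
  have h₃ := reachesIn_ver_load_vec k y x.reverse [] []
  rw [List.append_nil] at h₂ h₃
  rw [hx] at h₂ h₃
  generalize hN : x.length + y.length = N
  obtain ⟨src, d, hd, h₄⟩ := reachesIn_ver_rows k true false rows y.reverse y.reverse N
    (by rw [List.length_reverse]; omega) (by rw [List.length_reverse]; omega)
    (fun r hr => (hrows.2 r hr).trans (by omega))
  have h₅ := reachesIn_ver_clean k (checkRows k y.reverse rows y.reverse true false) src y.reverse d
  refine Eq.subst (motive := fun c => ReachesIn (verProgram k) c _ _) (h₀ _).symm ?_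
  refine Eq.subst (motive := fun c => ReachesIn (verProgram k) _ c _) (h₁ _).symm ?_
  refine (((h₂.trans h₃).trans h₄).trans h₅).mono ?_
  have : rows.length * (2 * N * N + 6 * N + 4) ≤ N * (2 * N * N + 6 * N + 4) :=
    Nat.mul_le_mul_right _ (by omega)
  rw [List.length_reverse]
  omega

end Verifier

/-! ### Certificates as strings, and membership in NP -/

section Membership

open Turing

/-- The string of bits that encodes a list of numbers in unary. -/
def encodeUnary (l : List ℕ) : List Bool :=
  l.flatMap fun m => List.replicate m true ++ [false]

theorem unaryHead_encodeUnary_cons (m : ℕ) (l : List ℕ) :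
    unaryHead (encodeUnary (m :: l)) = m := by
  rw [encodeUnary, List.flatMap_cons]
  induction m with
  | zero => simp [unaryHead]
  | succ m ih => simpa [List.replicate_succ, unaryHead] using ih

theorem unaryTail_encodeUnary_cons (m : ℕ) (l : List ℕ) :
    unaryTail (encodeUnary (m :: l)) = encodeUnary l := by
  rw [encodeUnary, List.flatMap_cons]
  induction m with
  | zero => simp [unaryTail, encodeUnary]
  | succ m ih => simpa [List.replicate_succ, unaryTail] using ih

variable {V : Type*}

/-- The string of bits `w` starts with the numbers `m v`, where `v` runs through a list. -/
def ReadsAs (m : V → ℕ) : List V → List Bool → Prop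
  | [], _ => True
  | v :: l, w => unaryHead w = m v ∧ ReadsAs m l (unaryTail w)

theorem readsAs_encodeUnary (m : V → ℕ) (l : List V) : ReadsAs m l (encodeUnary (l.map m)) := by
  induction l with
  | nil => trivial
  | cons v l ih =>
    rw [List.map_cons]
    exact ⟨unaryHead_encodeUnary_cons _ _, (unaryTail_encodeUnary_cons _ _).symm ▸ ih⟩

theorem ReadsAs.congr {m m' : V → ℕ} {l : List V} {w : List Bool} (h : ReadsAs m l w)
    (hm : ∀ v ∈ l, m v = m' v) : ReadsAs m' l w := by
  induction l generalizing w with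
  | nil => trivial
  | cons v l ih =>
    exact ⟨h.1.trans (hm v List.mem_cons_self),
      ih h.2 fun u hu => hm u (List.mem_cons_of_mem _ hu)⟩

/-- Missing numbers read as `0`, so no string is malformed. Soundness of the verifier therefore
needs no syntax check. -/
theorem exists_readsAs {l : List V} (hl : l.Nodup) (w : List Bool) : ∃ m, ReadsAs m l w := by
  classical
  induction l generalizing w with
  | nil => exact ⟨fun _ => 0, trivial⟩
  | cons v l ih =>
    obtain ⟨hv, hl⟩ := List.nodup_cons.1 hl
    obtain ⟨m, hm⟩ := ih hl (unaryTail w)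
    refine ⟨Function.update m v (unaryHead w), by simp, hm.congr fun u hu => ?_⟩
    rw [Function.update_of_ne]
    rintro rfl
    exact hv hu

variable (k : ℕ)

theorem mem_rowColors {m : V → ℕ} {l : List V} {w : List Bool} (h : ReadsAs m l w) (a : V → Bool)
    (b : ℕ) (S : Finset (Fin (k + 1))) (c : Fin (k + 1)) :
    c ∈ rowColors k b (l.map a) w S ↔
      c ∈ S ∨ ∃ u ∈ l, a u = true ∧ m u ≤ b ∧ Fin.ofNat (k + 1) (m u) = c := by
  induction l generalizing w S with
  | nil => simp [rowColors]
  | cons v l ih =>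
    rw [List.map_cons, rowColors, ih h.2, h.1]
    simp only [List.mem_cons, exists_eq_or_imp]
    rw [← or_assoc]
    refine or_congr_left ?_
    cases ha : a v
    · simp
    · by_cases hle : m v ≤ b
      · simp [hle, or_comm, eq_comm]
      · simp [hle]

/-- The flag `src` remembers whether an empty set `E v` has occurred, so passing all rows rules out
a second one. This is the pairwise condition, and the clause on `src` carries it through the
induction. -/
theorem checkRows_eq_true_iff {m : V → ℕ} {l : List V} {w d : List Bool} (row : V → List Bool)
    (h : ReadsAs m l d) (E : V → Finset (Fin (k + 1)))
    (hE : ∀ v ∈ l, rowColors k (m v) (row v) w ∅ = E v) (ok src : Bool) :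
    checkRows k w (l.map row) d ok src = true ↔
      ok = true ∧ (∀ v ∈ l, IsMex (Fin.ofNat (k + 1) (m v)) (E v)) ∧
        (src = true → ∀ v ∈ l, E v ≠ ∅) ∧ l.Pairwise fun u v => E u = ∅ → E v ≠ ∅ := by
  induction l generalizing d ok src with
  | nil => simp [checkRows]
  | cons v l ih =>
    rw [List.map_cons, checkRows]
    simp only [h.1, hE v List.mem_cons_self]
    rw [ih h.2 fun u hu => hE u (List.mem_cons_of_mem _ hu)]
    simp only [List.forall_mem_cons, List.pairwise_cons, Bool.and_eq_true, Bool.or_eq_true,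
      decide_eq_true_eq, Bool.not_eq_true', Bool.and_eq_false_iff, decide_eq_false_iff_not]
    cases src
    · simp only [Bool.false_eq_true, false_or, false_imp_iff, true_or, and_true, true_and]
      constructor
      · rintro ⟨⟨h₁, h₂⟩, h₃, h₄, h₅⟩
        exact ⟨h₁, ⟨h₂, h₃⟩, fun u hu hv => h₄ hv u hu, h₅⟩
      · rintro ⟨h₁, ⟨h₂, h₃⟩, h₄, h₅⟩
        exact ⟨⟨h₁, h₂⟩, h₃, fun hv u hu => h₄ u hu hv, h₅⟩
    · simp only [Bool.true_eq_false, false_or, true_or, true_imp_iff, ne_eq]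
      constructor
      · rintro ⟨⟨⟨h₁, h₂⟩, h₂'⟩, h₃, h₄, h₅⟩
        exact ⟨h₁, ⟨h₂, h₃⟩, ⟨h₂', h₄⟩, fun u hu _ => h₄ u hu, h₅⟩
      · rintro ⟨h₁, ⟨h₂, h₃⟩, ⟨h₂', h₄⟩, -, h₅⟩
        exact ⟨⟨⟨h₁, h₂⟩, h₂'⟩, h₃, h₄, h₅⟩

open Classical in
/-- A row of the adjacency matrix of a graph, reversed. -/
noncomputable def reversedRow {n : ℕ} (G : SimpleGraph (Fin n)) (i : Fin n) : List Bool :=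
  (List.finRange n).reverse.map fun j => decide (G.Adj i j)

/-- The adjacency matrix of a graph, reversed. -/
noncomputable def reversedRows (G : FinGraph) : List (List Bool) :=
  (List.finRange G.1).reverse.map (reversedRow G.2)

theorem reverse_encodeGraph (G : FinGraph) :
    (encodeGraph G).reverse = matrixStack (reversedRows G) := by
  rw [encodeGraph, List.reverse_flatMap, matrixStack, reversedRows, List.flatMap_map]
  refine List.flatMap_congr fun i _ => ?_
  simp [reversedRow, Function.comp_def]

theorem length_encodeGraph (G : FinGraph) : (encodeGraph G).length = G.1 * (G.1 + 1) := by
  simp [encodeGraph, List.length_flatMap]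

/-- The verifier accepts the certificate `x.2` for the graph `x.1`. -/
noncomputable def verify (x : FinGraph × List Bool) : Bool :=
  checkRows k x.2.reverse (reversedRows x.1) x.2.reverse true false

theorem polyTimeComputable_verify :
    PolyTimeComputable (encodeWithCertificate encodeGraph) Computability.encodeBool (verify k) := by
  refine ⟨{
    tm := verMachine k
    inputAlphabet := Equiv.refl _
    outputAlphabet := Equiv.refl _
    time := .X * (2 * .X * .X + 6 * .X + 4) + 4 * .X + 3
    outputsFun := fun x => (ReachesIn.evalsToInTime ?_).some }⟩
  simp only [Polynomial.eval_add, Polynomial.eval_mul, Polynomial.eval_X, Polynomial.eval_ofNat]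
  have := reachesIn_verMachine k (encodeGraph x.1) x.2 (reversedRows x.1) (reverse_encodeGraph x.1)
  have hlen : (encodeWithCertificate encodeGraph x).length =
      (encodeGraph x.1).length + x.2.length := by simp [encodeWithCertificate]
  rw [hlen]
  have h : (encodeWithCertificate encodeGraph x).map (Equiv.refl (Option Bool ⊕ Bool)).invFun =
      (encodeGraph x.1).map Sum.inl ++ x.2.map Sum.inr := List.map_id _
  exact Eq.mp (congrArg (fun i => ReachesIn (verMachine k).m (initList (verMachine k) i)
    (haltList (verMachine k) [verify k x]) _) h.symm) this

theorem verify_eq_true_iff {G : FinGraph} {y : List Bool} {m : Fin G.1 → ℕ}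
    (h : ReadsAs m (List.finRange G.1).reverse y.reverse) :
    verify k (G, y) = true ↔ IsCertificate k G.2 m := by
  have hE : ∀ v ∈ (List.finRange G.1).reverse,
      rowColors k (m v) (reversedRow G.2 v) y.reverse ∅ = earlierColors k G.2 m v := by
    intro v _
    ext c
    rw [reversedRow, mem_rowColors k h, mem_earlierColors]
    simp
  rw [verify, reversedRows, checkRows_eq_true_iff k _ h _ hE, IsCertificate]
  have hnodup : (List.finRange G.1).reverse.Nodup := List.nodup_reverse.2 (List.nodup_finRange _)
  have hpair : (List.finRange G.1).reverse.Pairwise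
        (fun u v => earlierColors k G.2 m u = ∅ → earlierColors k G.2 m v ≠ ∅) ↔
      ∀ u v, earlierColors k G.2 m u = ∅ → earlierColors k G.2 m v = ∅ → u = v := by
    constructor
    · intro hp u v hu hv
      -- By symmetry the order of the list is irrelevant, so the pairwise condition applies to any
      -- two distinct vertices.
      have : Std.Symm fun u v => earlierColors k G.2 m u = ∅ → earlierColors k G.2 m v ≠ ∅ :=
        ⟨fun _ _ h h₁ h₂ => h h₂ h₁⟩
      by_contra hne
      exact hp.set_pairwise (by simp) (by simp) hne hu hv
    · exact fun h => hnodup.pairwise_of_forall_ne fun u _ v _ hne hu hv => hne (h u v hu hv)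
  simp [hpair]

/-- The graphs with connected chromatic number at most `k + 1` can be verified in polynomial
time. -/
theorem inNP_connectedChromaticNumber_le (I : Set FinGraph) :
    InNP encodeGraph I {G | connectedChromaticNumber G.2 ≤ ((k + 1 : ℕ) : ℕ∞)} := by
  -- For `n` vertices the unary certificate has length `∑ v, (m v + 1) ≤ n * (n * (k + 1))`, and the
  -- encoding of the graph has length `n * (n + 1)`.
  refine ⟨.C (k + 1) * .X, verify k, polyTimeComputable_verify k, fun G _ => ⟨fun h => ?_, ?_⟩⟩
  · obtain ⟨m, hm, hcert⟩ := exists_isCertificate h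
    refine ⟨(encodeUnary ((List.finRange G.1).reverse.map m)).reverse, ?_,
      (verify_eq_true_iff k ?_).2 hcert⟩
    · have hlen : (encodeUnary ((List.finRange G.1).reverse.map m)).length =
          ∑ v, (m v + 1) := by
        rw [encodeUnary, List.length_flatMap, List.map_map, List.map_reverse, List.sum_reverse,
          ← List.sum_ofFn, List.ofFn_eq_map]
        simp [Function.comp_def]
      have hsum : ∑ v, (m v + 1) ≤ ∑ _ : Fin G.1, G.1 * (k + 1) :=
        Finset.sum_le_sum fun v _ => hm v
      rw [List.length_reverse, hlen]
      refine hsum.trans ?_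
      rw [Finset.sum_const, Finset.card_univ, Fintype.card_fin, smul_eq_mul, length_encodeGraph,
        Polynomial.eval_mul, Polynomial.eval_C, Polynomial.eval_X]
      nlinarith [Nat.zero_le (G.1 * (k + 1))]
    · rw [List.reverse_reverse]
      exact readsAs_encodeUnary _ _
  · rintro ⟨y, -, hy⟩
    obtain ⟨m, hm⟩ := exists_readsAs (List.nodup_reverse.2 (List.nodup_finRange G.1)) y.reverse
    exact ((verify_eq_true_iff k hm).1 hy).connectedChromaticNumber_le

end Membership

/-! ### NP-hardness and the theorem -/

/-- The target class `I` is kept general so that one reduction yields hardness both on `𝒢` and on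
its connected members. -/
theorem npHard_connectedChromaticNumber_le {𝒢 : Set FinGraph} {k : ℕ}
    (h𝒢 : ∀ (n : ℕ) (G : SimpleGraph (Fin n)),
      (⟨n, G⟩ : FinGraph) ∈ 𝒢 → (⟨n + 1, addUniversalVertex G⟩ : FinGraph) ∈ 𝒢)
    (h : NPHard encodeGraph 𝒢 {G | G.2.chromaticNumber ≤ (k : ℕ∞)}) {I : Set FinGraph}
    (hI : ∀ G ∈ 𝒢, G.2.Connected → G ∈ I) :
    NPHard encodeGraph I {G | connectedChromaticNumber G.2 ≤ ((k + 1 : ℕ) : ℕ∞)} := by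
  intro L hL
  obtain ⟨f, hf, hfL⟩ := h L hL
  refine ⟨_, polyTimeComputable_addUniversalVertex.comp hf, fun x => ⟨hI _ (h𝒢 _ _ (hfL x).1)
    (addUniversalVertex_connected _), (hfL x).2.trans ?_⟩⟩
  simp only [Function.comp_apply, Set.mem_ofPred_eq, connectedChromaticNumber_addUniversalVertex,
    Nat.cast_add, Nat.cast_one]
  -- Adding `1` can be cancelled in `ℕ∞` because `1` is finite.
  exact (WithTop.add_le_add_iff_right WithTop.one_ne_top).symm

theorem mainTheorem9 :
    (∀ (𝒢 : Set FinGraph) (k : ℕ),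
      (∀ (n : ℕ) (G : SimpleGraph (Fin n)),
        (⟨n, G⟩ : FinGraph) ∈ 𝒢 → (⟨n + 1, addUniversalVertex G⟩ : FinGraph) ∈ 𝒢) →
      ColoringNPComplete 𝒢 k →
        ConnectedColoringNPComplete 𝒢 (k + 1) ∧
        ConnectedColoringNPComplete {G | G ∈ 𝒢 ∧ G.2.Connected} (k + 1)) ∧
    (∀ (n : ℕ) (G : SimpleGraph (Fin n)),
      connectedChromaticNumber (addUniversalVertex G) = G.chromaticNumber + 1) := by
  refine ⟨fun 𝒢 k h𝒢 h => ⟨⟨inNP_connectedChromaticNumber_le k _, ?_⟩,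
    ⟨inNP_connectedChromaticNumber_le k _, ?_⟩⟩,
    fun n G => connectedChromaticNumber_addUniversalVertex G⟩
  · exact npHard_connectedChromaticNumber_le h𝒢 h.2 fun G hG _ => hG
  · exact npHard_connectedChromaticNumber_le h𝒢 h.2 fun G hG hG' => ⟨hG, hG'⟩
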